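/- Let $p>2$ be a prime and $k=\mathbf F_p$. Let $V_n^*$ be the space of homogeneous polynomials (binary forms) of degree $n$ in $k[x,y]$, let $V_n$ be its dual space, and let $(\cdot,\cdot)\colon V_n\times V_n^*\to k$ be the natural pairing. A form $v\in V_n^*$ is singular if it is divisible by $g^2$ for some non-constant polynomial $g$ (in particular $v=0$ is singular); let $\Phi$ be the indicator function of the singular forms. For $w\in V_5$ put $$\widehat\Phi(w)=\frac1{\#V_5^*}\sum_{v\in V_5^*}\Phi(v)\exp\!\Big(\frac{2\pi i\,(w,v)}p\Big).$$ For $v\in V_m^*$ with $m\le 5$, let $(w,v)\in V_{5-m}$ be the functional $u\mapsto (w,vu)$, and put $(w,v)=0$ if $m>5$. Extend this linearly to $v\in k[x,y]$, and let $w^\perp=\{v\in k[x,y]\mid (w,v)=0\}$ be the apolar ideal of $w$. Let $s$ be the rank of the $3\times4$ matrix $(a_{i+j})_{0\le i\le 2,\,0\le j\le 3}$, where $a_i=(w,x^{5-i}y^i)$; there is a nonzero form of degree $s$ in $w^\perp$, it is unique up to a scalar, and it is the generator of $w^\perp$ of smallest degree. The Waring type of $w$ is the splitting type of this form, where a form that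 is a nonzero constant times $f_1^{e_1}\cdots f_r^{e_r}$, with pairwise non-proportional irreducible forms $f_i$ of degree $d_i$ and exponents $e_i\ge1$, has splitting type $\langle d_1^{e_1},\dots,d_r^{e_r}\rangle$. Theorem. For every $w\in V_5$, $$\widehat\Phi(w)=\begin{cases}p^{-1}+p^{-2}-p^{-3} & (w=0),\\ p^{-2}-p^{-3} & (w\text{ of Waring type }\langle1\rangle),\\ p^{-2}-p^{-3} & (w\text{ of Waring type }\langle1^2\rangle),\\ C(w)\,p^{-4} & (\text{otherwise}),\end{cases}$$ where, in the last case, $$C(w)=-\sum_{\substack{[f]\in\mathbf P(V_2^*)\\ f^2\in w^\perp}}\Big(\frac{\operatorname{Disc} f}p\Big)\in\begin{cases}\{-1\} & (\text{Waring type }\langle1,1\rangle),\\ \{1\} & (\text{Waring type }\langle2\rangle),\\ \{0,\pm1\} & (\text{Waring type }\langle1^3\rangle),\\ \{0,\pm1,-2,-3\} & (\text{Waring type }\langle1^2,1\rangle),\\ \{0,\pm1,\pm2,\pm3,\pm4\} & (\text{other Waring types}).\end{cases}$$ Here the sum is over the $\mathbf F_p$-rational points $[f]$ of $\mathbf P(V_2^*)$,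 $\operatorname{Disc}(ax^2+bxy+cy^2)=b^2-4ac$, and $\big(\frac{\cdot}{p}\big)$ is the Legendre symbol. -/

import Mathlib

open MvPolynomial
open scoped LinearAlgebra.Projectivization

noncomputable section

namespace BinaryForms

/-- The space `V_n^*` of binary forms of degree `n` over `k`, as the space of homogeneous polynomials
of degree `n` in the two variables `x = X 0`, `y = X 1`. -/
abbrev Form (k : Type*) [Field k] (n : ℕ) : Submodule k (MvPolynomial (Fin 2) k) :=
  homogeneousSubmodule (Fin 2) k n

/-- The space `V_n`, the dual of `V_n^*`; the pairing `(w, v)` is `w v`. -/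
abbrev DualForm (k : Type*) [Field k] (n : ℕ) : Type _ :=
  Module.Dual k (Form k n)

instance instFiniteForm (k : Type*) [Field k] [Finite k] (n : ℕ) : Finite (Form k n) := by
  have hs : Set.Finite {d : Fin 2 →₀ ℕ | d.degree = n} := by
    refine Set.Finite.subset
      (Set.finite_Iic (Finsupp.equivFunOnFinite.symm (fun _ : Fin 2 => n))) ?_
    intro d hd i
    have hd' : d.degree = n := hd
    have := Finsupp.le_degree i d
    simpa [hd'] using this
  have := hs.to_subtype
  refine Finite.of_injective
    (fun (f : Form k n) (d : {d : Fin 2 →₀ ℕ | d.degree = n}) => coeff d.1 f.1) ?_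
  intro f g hfg
  apply Subtype.ext
  ext d
  by_cases hd : d.degree = n
  · exact congrFun hfg ⟨d, hd⟩
  · have hf : f.1.IsHomogeneous n := f.2
    have hg : g.1.IsHomogeneous n := g.2
    rw [hf.coeff_eq_zero hd, hg.coeff_eq_zero hd]

instance instFintypeForm (k : Type*) [Field k] [Finite k] (n : ℕ) : Fintype (Form k n) :=
  Fintype.ofFinite _

instance instFintypeProjForm (k : Type*) [Field k] [Finite k] (n : ℕ) :
    Fintype (ℙ k (Form k n)) :=
  have : Finite (ℙ k (Form k n)) := Quotient.finite _
  Fintype.ofFinite _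

/-- A form is singular if it has a multiple (nonconstant) factor; the zero form is singular. -/
def IsSingular {k : Type*} [Field k] (f : MvPolynomial (Fin 2) k) : Prop :=
  ∃ g : MvPolynomial (Fin 2) k, ¬ IsUnit g ∧ g ^ 2 ∣ f

open scoped Classical in
/-- The Fourier transform `w ↦ (1 / #V_n^*) ∑_v Φ(v) exp(2 π i (w, v) / p)` of the indicator function
`Φ` of the singular forms in `V_n^*`, over the field with `p` elements. -/
def singularExpSum {p : ℕ} [Fact p.Prime] {n : ℕ} (w : DualForm (ZMod p) n) : ℂ :=
  (1 / (Fintype.card (Form (ZMod p) n) : ℂ)) *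
    ∑ v : Form (ZMod p) n,
      (if IsSingular (v : MvPolynomial (Fin 2) (ZMod p)) then (1 : ℂ) else 0) *
        Complex.exp (2 * Real.pi * Complex.I * ((w v).val : ℂ) / (p : ℂ))

/-- `w ∈ V_n`, viewed as a functional on `k[x, y]` that vanishes on the forms of degree `≠ n`. -/
def extend {k : Type*} [Field k] {n : ℕ} (w : DualForm k n) :
    Module.Dual k (MvPolynomial (Fin 2) k) :=
  w ∘ₗ (homogeneousComponent n).codRestrict (Form k n) (fun f => homogeneousComponent_mem n f)

/-- The polar pairing `(w, v) : u ↦ (w, v u)`. If `v` is a form of degree `m ≤ n`, this functional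
is zero on forms of degree `≠ n - m`, so that it is an element of `V_{n-m}`; if `m > n`, it is
zero. -/
def polar {k : Type*} [Field k] {n : ℕ} (w : DualForm k n) (v : MvPolynomial (Fin 2) k) :
    Module.Dual k (MvPolynomial (Fin 2) k) :=
  extend w ∘ₗ LinearMap.mulLeft k v

/-- The apolar ideal `w^⊥ = {v ∈ k[x, y] | (w, v) = 0}`. -/
def apolarIdeal {k : Type*} [Field k] {n : ℕ} (w : DualForm k n) :
    Ideal (MvPolynomial (Fin 2) k) where
  carrier := {v | polar w v = 0}
  zero_mem' := by
    ext u
    simp [polar]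
  add_mem' := by
    intro a b ha hb
    have ha' : polar w a = 0 := ha
    have hb' : polar w b = 0 := hb
    refine LinearMap.ext fun u => ?_
    have h1 := LinearMap.congr_fun ha' u
    have h2 := LinearMap.congr_fun hb' u
    simp only [polar, LinearMap.comp_apply, LinearMap.mulLeft_apply, LinearMap.zero_apply]
      at h1 h2 ⊢
    rw [add_mul, map_add, h1, h2, add_zero]
  smul_mem' := by
    intro c a ha
    have ha' : polar w a = 0 := ha
    refine LinearMap.ext fun u => ?_
    have h1 := LinearMap.congr_fun ha' (c * u)
    simp only [polar, LinearMap.comp_apply, LinearMap.mulLeft_apply, LinearMap.zero_apply,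
      smul_eq_mul] at h1 ⊢
    rw [← h1]
    congr 1
    ring

/-- The coordinate `a_i = (w, x^{n-i} y^i)` of `w ∈ V_n`, for `i ≤ n`, so that
`w = a_0 (x^n)^* + a_1 (x^{n-1}y)^* + ⋯ + a_n (y^n)^*` in the basis dual to the monomials. -/
def coord {k : Type*} [Field k] {n : ℕ} (w : DualForm k n) (i : ℕ) : k :=
  extend w (X 0 ^ (n - i) * X 1 ^ i)

/-- The catalecticant matrix `A_{s,t;r}(w)`, with `t + 1` rows, `s + 1` columns and the entries
`a_{r+i+j}`; it is used for `r + s + t ≤ n`. -/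
def catalecticant {k : Type*} [Field k] {n : ℕ} (w : DualForm k n) (s t r : ℕ) :
    Matrix (Fin (t + 1)) (Fin (s + 1)) k :=
  Matrix.of fun i j => coord w (r + i + j)

/-- The catalecticant rank of `w ∈ V_n`, for odd `n = 2m + 1`: the rank of `A_{m+1,m;0}(w)`. -/
def catalecticantRank {k : Type*} [Field k] {n : ℕ} (w : DualForm k n) : ℕ :=
  (catalecticant w (n / 2 + 1) (n / 2) 0).rank

/-- `f` has the splitting type `⟨d_1^{e_1}, …, d_r^{e_r}⟩`, given as the multiset of the pairs
`(d_i, e_i)`: up to a nonzero constant, `f = f_1^{e_1} ⋯ f_r^{e_r}` with pairwise non-proportional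
irreducible forms `f_i` of degree `d_i` and exponents `e_i ≥ 1`. -/
def HasSplittingType {k : Type*} [Field k] (f : MvPolynomial (Fin 2) k)
    (T : Multiset (ℕ × ℕ)) : Prop :=
  ∃ (r : ℕ) (g : Fin r → MvPolynomial (Fin 2) k) (d e : Fin r → ℕ),
    (∀ i, Irreducible (g i) ∧ (g i).IsHomogeneous (d i) ∧ 1 ≤ e i) ∧
    (∀ i j, i ≠ j → ¬ Associated (g i) (g j)) ∧
    Associated f (∏ i, g i ^ e i) ∧
    T = Finset.univ.val.map (fun i => (d i, e i))

/-- `w ∈ V_n` (`n` odd) has Waring type `T`: the generator of `w^⊥` of smallest degree, i.e. the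
nonzero form in `w^⊥` whose degree is the catalecticant rank of `w` (it is unique up to a constant),
has splitting type `T`. -/
def HasWaringType {k : Type*} [Field k] {n : ℕ} (w : DualForm k n)
    (T : Multiset (ℕ × ℕ)) : Prop :=
  ∃ φ : Form k (catalecticantRank w), φ ≠ 0 ∧
    (φ : MvPolynomial (Fin 2) k) ∈ apolarIdeal w ∧
    HasSplittingType (φ : MvPolynomial (Fin 2) k) T

/-- The discriminant `b^2 - 4ac` of a binary quadratic form `a x^2 + b x y + c y^2`. -/
def quadDisc {k : Type*} [Field k] (f : Form k 2) : k :=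
  coeff (Finsupp.single 0 1 + Finsupp.single 1 1) f.1 ^ 2
    - 4 * coeff (Finsupp.single 0 2) f.1 * coeff (Finsupp.single 1 2) f.1

open scoped Classical in
/-- `C(w) = - ∑ (Disc f / p)`, over the points `[f]` of `P(V_2^*)` with `f^2 ∈ w^⊥`. Neither the
condition nor the Legendre symbol depends on the representative `f` of `[f]`. -/
def legendreSum {p : ℕ} [Fact p.Prime] {n : ℕ} (w : DualForm (ZMod p) n) : ℤ :=
  - ∑ f : ℙ (ZMod p) (Form (ZMod p) 2) with
      (f.rep : MvPolynomial (Fin 2) (ZMod p)) ^ 2 ∈ apolarIdeal w,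
    quadraticChar (ZMod p) (quadDisc f.rep)

end BinaryForms

end

open MvPolynomial
open scoped LinearAlgebra.Projectivization

noncomputable section

namespace BinaryForms

section

variable {k : Type*} [Field k]

/-! ### Divisors of forms -/

/-! Divisibility by a given form is a linear condition, so its Fourier transform is explicit; the
proof writes $\Phi$ as a combination of such conditions. For a nonzero quintic $v$ let $g$ be a form
of largest degree with $g^2\mid v$. Then $f^2\mid v$ if and only if $f\mid g$, and $\deg g\le2$. A
nonzero quadratic form $g$ has $1+\chi(\operatorname{Disc} g)$ linear divisors up to scalars, where
$\chi$ is the quadratic character, so that $\Phi(v)=\sum_{[l]}1_{l^2\mid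
v}-\sum_{[f]}\chi(\operatorname{Disc} f)1_{f^2\mid v}$, with $l$ linear and $f$ quadratic; this also
holds for $v=0$ (`indicator_isSingular`). By orthogonality of characters the indicator of the
multiples of a form $h$ of degree $d$ has transform $p^{-d}$ if $h\in w^\perp$ and $0$ if not
(`sum_stdAddChar_of_dvd`). Hence $\widehat\Phi(w)=Np^{-2}+C(w)p^{-4}$, where $N$ is the number of
$[l]$ with $l^2\in w^\perp$ (`singularExpSum_eq`).

For $w\ne0$, $N\neq0$ means Waring type $\langle1\rangle$ or $\langle1^2\rangle$; then $N=1$ and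
$C(w)=-p$ (`counts_of_l_sq`). For the other types with special values, coordinates adapted to the
generator of $w^\perp$ make the condition $f^2\in w^\perp$ solvable by hand.

In the remaining types $w$ has no apolar quadratic form. The points $[f]$ in question are the
intersection of the two conics $(w,f^2x)=(w,f^2y)=0$ in the plane $\mathbf P(V_2^*)$. The conics
have no common line (`not_isotropic`), so no three common points are collinear, and five common
points would make some member of the pencil vanish identically (`not_exists_five_points`). So there
are at most four points and $|C(w)|\le4$. -/

/-- The substitution `x ↦ x t`, `y ↦ y t`. -/
def dilate (k : Type*) [Field k] :
    MvPolynomial (Fin 2) k →ₐ[k] Polynomial (MvPolynomial (Fin 2) k) :=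
  aeval fun i => Polynomial.C (X i) * Polynomial.X

lemma dilate_of_isHomogeneous {f : MvPolynomial (Fin 2) k} {n : ℕ} (hf : f.IsHomogeneous n) :
    dilate k f = Polynomial.monomial n f := by
  have key : ∀ d : Fin 2 →₀ ℕ, ∀ c : k, dilate k (monomial d c) =
      Polynomial.monomial d.degree (monomial d c) := by
    intro d c
    rw [dilate, aeval_monomial, Finsupp.prod_fintype _ _ (fun _ => pow_zero _)]
    simp only [Fin.prod_univ_two, mul_pow]
    rw [Finsupp.degree_eq_sum, Fin.sum_univ_two, ← Polynomial.C_mul_X_pow_eq_monomial,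
      monomial_eq, Finsupp.prod_fintype _ _ (fun _ => pow_zero _), Fin.prod_univ_two, pow_add]
    simp only [map_mul, map_pow]
    rw [IsScalarTower.algebraMap_apply k (MvPolynomial (Fin 2) k), algebraMap_eq,
      Polynomial.algebraMap_eq]
    ring
  conv_lhs => rw [f.as_sum]
  conv_rhs => rw [f.as_sum]
  rw [map_sum, map_sum]
  refine Finset.sum_congr rfl fun d hd => ?_
  rw [key, show d.degree = n from not_imp_comm.mp (hf.coeff_eq_zero (d := d)) (mem_support_iff.mp hd)]

lemma coeff_dilate (f : MvPolynomial (Fin 2) k) (n : ℕ) :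
    (dilate k f).coeff n = homogeneousComponent n f := by
  conv_lhs => rw [← sum_homogeneousComponent f, map_sum, Polynomial.finsetSum_coeff]
  simp only [dilate_of_isHomogeneous (homogeneousComponent_isHomogeneous _ f),
    Polynomial.coeff_monomial]
  rw [Finset.sum_ite_eq']
  split_ifs with h
  · rfl
  · rw [homogeneousComponent_eq_zero]
    simpa using h

lemma dilate_injective : Function.Injective (dilate k) := by
  intro f g h
  have h1 : ∀ n, homogeneousComponent n f = homogeneousComponent n g := fun n => by
    rw [← coeff_dilate, ← coeff_dilate, h]
  ext d
  have := congrArg (coeff d) (h1 d.degree)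
  simp only [coeff_homogeneousComponent, if_true] at this
  exact this

/-- A factor of a nonzero form is a form. -/
lemma exists_isHomogeneous_of_mul {f g : MvPolynomial (Fin 2) k} {n : ℕ}
    (h : (f * g).IsHomogeneous n) (h0 : f * g ≠ 0) :
    ∃ i j, i + j = n ∧ f.IsHomogeneous i ∧ g.IsHomogeneous j := by
  -- The product is a single monomial in $t$. Degrees and trailing degrees both add up, so they
  -- coincide in each factor, which therefore has only one homogeneous component.
  have hd : dilate k f * dilate k g = Polynomial.monomial n (f * g) := by
    rw [← map_mul, dilate_of_isHomogeneous h]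
  have hf : dilate k f ≠ 0 := fun e => left_ne_zero_of_mul h0 (dilate_injective (by simpa using e))
  have hg : dilate k g ≠ 0 := fun e => right_ne_zero_of_mul h0 (dilate_injective (by simpa using e))
  have h1 := congrArg Polynomial.natDegree hd
  rw [Polynomial.natDegree_mul hf hg, Polynomial.natDegree_monomial_eq _ h0] at h1
  have h2 := congrArg Polynomial.natTrailingDegree hd
  rw [Polynomial.natTrailingDegree_mul hf hg, Polynomial.natTrailingDegree_monomial h0] at h2
  have h3 := Polynomial.natTrailingDegree_le_natDegree (dilate k f)
  have h4 := Polynomial.natTrailingDegree_le_natDegree (dilate k g)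
  have key : ∀ q : MvPolynomial (Fin 2) k,
      (dilate k q).natTrailingDegree = (dilate k q).natDegree →
      q.IsHomogeneous (dilate k q).natDegree := by
    intro q hq
    have : q = homogeneousComponent (dilate k q).natDegree q := by
      refine dilate_injective ?_
      rw [dilate_of_isHomogeneous (homogeneousComponent_isHomogeneous _ q), ← coeff_dilate]
      ext1 j
      rw [Polynomial.coeff_monomial]
      split_ifs with hj
      · rw [hj]
      · rcases lt_or_gt_of_ne hj with hj | hj
        · exact Polynomial.coeff_eq_zero_of_natDegree_lt hj
        · exact Polynomial.coeff_eq_zero_of_lt_natTrailingDegree (hq ▸ hj)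
    generalize (dilate k q).natDegree = N at this
    rw [this]
    exact homogeneousComponent_isHomogeneous N q
  exact ⟨_, _, h1, key f (by omega), key g (by omega)⟩

lemma isUnit_of_isHomogeneous_zero {f : MvPolynomial (Fin 2) k} (h : f.IsHomogeneous 0)
    (h0 : f ≠ 0) : IsUnit f := by
  have := totalDegree_eq_zero_iff_eq_C.mp ((totalDegree_zero_iff_isHomogeneous _).mpr h)
  rw [this] at h0 ⊢
  exact (IsUnit.mk0 _ fun e => h0 (by rw [e, map_zero])).map C

lemma eq_C_of_isHomogeneous_zero {f : MvPolynomial (Fin 2) k} (h : f.IsHomogeneous 0) :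
    ∃ c : k, f = C c :=
  ⟨_, totalDegree_eq_zero_iff_eq_C.mp ((totalDegree_zero_iff_isHomogeneous _).mpr h)⟩

lemma isHomogeneous_zero_of_isUnit {f : MvPolynomial (Fin 2) k} (h : IsUnit f) :
    f.IsHomogeneous 0 := by
  obtain ⟨g, hg⟩ := h.exists_right_inv
  obtain ⟨i, j, hij, hi, -⟩ := exists_isHomogeneous_of_mul (f := f) (g := g) (n := 0)
    (by rw [hg]; exact isHomogeneous_one _ _) (by rw [hg]; exact one_ne_zero)
  obtain rfl : i = 0 := by omega
  exact hi

lemma irreducible_of_isHomogeneous_one {f : MvPolynomial (Fin 2) k} (h : f.IsHomogeneous 1)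
    (h0 : f ≠ 0) : Irreducible f := by
  refine ⟨fun hu => ?_, fun a b hab => ?_⟩
  · exact absurd (h.inj_right (isHomogeneous_zero_of_isUnit hu) h0) one_ne_zero
  · subst hab
    obtain ⟨i, j, hij, hi, hj⟩ := exists_isHomogeneous_of_mul h h0
    rcases Nat.eq_zero_or_pos i with rfl | hi0
    · exact Or.inl (isUnit_of_isHomogeneous_zero hi (left_ne_zero_of_mul h0))
    · obtain rfl : j = 0 := by omega
      exact Or.inr (isUnit_of_isHomogeneous_zero hj (right_ne_zero_of_mul h0))

/-- A form that divides a nonzero form of the same degree is proportional to it. -/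
lemma exists_smul_eq_of_dvd {f g : MvPolynomial (Fin 2) k} {n : ℕ} (hf : f.IsHomogeneous n)
    (hg : g.IsHomogeneous n) (h0 : g ≠ 0) (h : f ∣ g) : ∃ c : k, c ≠ 0 ∧ g = C c * f := by
  obtain ⟨u, rfl⟩ := h
  obtain ⟨i, j, hij, hi, hj⟩ := exists_isHomogeneous_of_mul hg h0
  have hin := hi.inj_right hf (left_ne_zero_of_mul h0)
  obtain rfl : j = 0 := by omega
  obtain ⟨c, rfl⟩ := eq_C_of_isHomogeneous_zero hj
  exact ⟨c, fun e => h0 (by simp [e]), mul_comm _ _⟩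

lemma dvd_iff_mk_eq {n : ℕ} {f g : Form k n} (hf : f ≠ 0) (hg : g ≠ 0) :
    (f : MvPolynomial (Fin 2) k) ∣ g ↔ Projectivization.mk k f hf = Projectivization.mk k g hg := by
  rw [Projectivization.mk_eq_mk_iff']
  constructor
  · intro h
    obtain ⟨c, hc, e⟩ := exists_smul_eq_of_dvd f.2 g.2 (by simpa using hg) h
    refine ⟨c⁻¹, Subtype.ext ?_⟩
    rw [Submodule.coe_smul, e, smul_eq_C_mul, ← mul_assoc, ← map_mul, inv_mul_cancel₀ hc, map_one,
      one_mul]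
  · rintro ⟨c, e⟩
    have hc : c ≠ 0 := fun h => hf (by rw [← e, h, zero_smul])
    refine ⟨C c⁻¹, ?_⟩
    rw [← e, Submodule.coe_smul, smul_eq_C_mul, mul_comm, ← mul_assoc, ← map_mul,
      inv_mul_cancel₀ hc, map_one, one_mul]

/-! ### Functionals and the apolar ideal -/

section
variable {n : ℕ} (w : DualForm k n)

lemma extend_coe (v : Form k n) : extend w v = w v := by
  rw [extend, LinearMap.comp_apply]
  congr 1
  apply Subtype.ext
  rw [LinearMap.codRestrict_apply]
  exact homogeneousComponent_eq_self v.2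

lemma extend_eq_zero {v : MvPolynomial (Fin 2) k} {m : ℕ} (hv : v.IsHomogeneous m) (h : m ≠ n) :
    extend w v = 0 := by
  rw [extend, LinearMap.comp_apply]
  convert map_zero w
  apply Subtype.ext
  rw [LinearMap.codRestrict_apply, homogeneousComponent_of_mem hv, if_neg h.symm]
  rfl

lemma extend_C_mul (c : k) (v : MvPolynomial (Fin 2) k) :
    extend w (C c * v) = c * extend w v := by
  rw [← smul_eq_C_mul, map_smul, smul_eq_mul]

variable {w}

lemma mem_apolarIdeal {v : MvPolynomial (Fin 2) k} :
    v ∈ apolarIdeal w ↔ ∀ u, extend w (v * u) = 0 := by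
  change polar w v = 0 ↔ _
  rw [LinearMap.ext_iff]
  rfl

/-- Only the component of $u$ of degree $e$ matters, because $w$ vanishes in degrees other than $n$.
-/
lemma mem_apolarIdeal_of_forall_form {d e : ℕ} (hn : d + e = n) {v : MvPolynomial (Fin 2) k}
    (hv : v.IsHomogeneous d) (h : ∀ u : MvPolynomial (Fin 2) k, u.IsHomogeneous e →
      extend w (v * u) = 0) : v ∈ apolarIdeal w := by
  rw [mem_apolarIdeal]
  intro u
  rw [← sum_homogeneousComponent u, Finset.mul_sum, map_sum]
  refine Finset.sum_eq_zero fun i _ => ?_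
  by_cases hi : i = e
  · subst hi
    exact h _ (homogeneousComponent_isHomogeneous _ u)
  · exact extend_eq_zero w (hv.mul (homogeneousComponent_isHomogeneous i u)) (by omega)

variable (w) in
/-- The forms of degree `d` in the apolar ideal. -/
def apolarForms (d : ℕ) : Submodule k (Form k d) :=
  ((apolarIdeal w).restrictScalars k).comap (Form k d).subtype

lemma mem_apolarForms {d : ℕ} {v : Form k d} :
    v ∈ apolarForms w d ↔ (v : MvPolynomial (Fin 2) k) ∈ apolarIdeal w := Iff.rfl

end

/-! ### Coordinates -/

/-- The form `∑ c_i x^{n-i} y^i`. -/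
def formOfCoeffs (k : Type*) [Field k] (n : ℕ) : (Fin (n + 1) → k) →ₗ[k] Form k n where
  toFun c := ⟨∑ i : Fin (n + 1), C (c i) * (X 0 ^ (n - i : ℕ) * X 1 ^ (i : ℕ)),
    IsHomogeneous.sum _ _ _ fun i _ => by
      refine IsHomogeneous.C_mul ?_ _
      have := ((isHomogeneous_X_pow (R := k) (0 : Fin 2) (n - i : ℕ)).mul
        (isHomogeneous_X_pow (1 : Fin 2) (i : ℕ)))
      rwa [Nat.sub_add_cancel (Nat.lt_succ_iff.mp i.2)] at this⟩
  map_add' c d := by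
    apply Subtype.ext
    simp [add_mul, Finset.sum_add_distrib]
  map_smul' a c := by
    apply Subtype.ext
    simp [Finset.smul_sum, smul_eq_C_mul, mul_assoc]

lemma coe_formOfCoeffs (n : ℕ) (c : Fin (n + 1) → k) :
    (formOfCoeffs k n c : MvPolynomial (Fin 2) k) =
      ∑ i : Fin (n + 1), C (c i) * (X 0 ^ (n - i : ℕ) * X 1 ^ (i : ℕ)) := rfl

/-- The exponent of the monomial `x^a y^b`. -/
def expo (a b : ℕ) : Fin 2 →₀ ℕ := Finsupp.single 0 a + Finsupp.single 1 b

lemma expo_inj {a b c d : ℕ} : expo a b = expo c d ↔ a = c ∧ b = d := by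
  constructor
  · intro h
    have h0 := DFunLike.congr_fun h 0
    have h1 := DFunLike.congr_fun h 1
    simpa [expo] using And.intro h0 h1
  · rintro ⟨rfl, rfl⟩
    rfl

lemma eq_expo (d : Fin 2 →₀ ℕ) : d = expo (d 0) (d 1) := by
  ext i
  fin_cases i <;> simp [expo]

lemma degree_expo (a b : ℕ) : (expo a b).degree = a + b := by
  simp [expo]

lemma X_pow_mul_X_pow (a b : ℕ) :
    (X 0 ^ a * X 1 ^ b : MvPolynomial (Fin 2) k) = monomial (expo a b) 1 := by
  rw [X_pow_eq_monomial, X_pow_eq_monomial, monomial_mul, one_mul, expo]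

lemma coeff_formOfCoeffs (n : ℕ) (c : Fin (n + 1) → k) (i : Fin (n + 1)) :
    coeff (expo (n - i) i) (formOfCoeffs k n c : MvPolynomial (Fin 2) k) = c i := by
  rw [coe_formOfCoeffs, coeff_sum, Finset.sum_eq_single i]
  · rw [X_pow_mul_X_pow, coeff_C_mul, coeff_monomial, if_pos rfl, mul_one]
  · intro j _ hj
    rw [X_pow_mul_X_pow, coeff_C_mul, coeff_monomial, if_neg, mul_zero]
    rw [expo_inj]
    exact fun h => hj (Fin.ext h.2)
  · simp

/-- The coordinates of a form. -/
def formEquiv (k : Type*) [Field k] (n : ℕ) : (Fin (n + 1) → k) ≃ₗ[k] Form k n :=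
  LinearEquiv.ofBijective (formOfCoeffs k n) <| by
    constructor
    · intro c d h
      ext i
      rw [← coeff_formOfCoeffs n c i, h, coeff_formOfCoeffs]
    · intro f
      refine ⟨fun i => coeff (expo (n - i) i) f.1, Subtype.ext ?_⟩
      ext d
      by_cases hd : d.degree = n
      · rw [eq_expo d, degree_expo] at hd
        have h1 : d 1 < n + 1 := by omega
        have h2 := coeff_formOfCoeffs n (fun i => coeff (expo (n - i) i) f.1) ⟨d 1, h1⟩
        have h3 : n - d 1 = d 0 := by omega
        simp only [h3, ← eq_expo d] at h2
        exact h2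
      · rw [IsHomogeneous.coeff_eq_zero (formOfCoeffs k n _).2 hd, IsHomogeneous.coeff_eq_zero f.2 hd]

lemma formEquiv_apply (n : ℕ) (c : Fin (n + 1) → k) : formEquiv k n c = formOfCoeffs k n c := rfl

lemma finrank_form (n : ℕ) : Module.finrank k (Form k n) = n + 1 := by
  rw [← (formEquiv k n).finrank_eq, Module.finrank_fin_fun]

instance instFiniteDimensionalForm (n : ℕ) : FiniteDimensional k (Form k n) :=
  (formEquiv k n).finiteDimensional

lemma card_form [Fintype k] (n : ℕ) : Fintype.card (Form k n) = Fintype.card k ^ (n + 1) := by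
  rw [← Fintype.card_congr (formEquiv k n).toEquiv]
  simp

/-! ### The catalecticant rank -/

/-- The catalecticant is the matrix of $f\mapsto(w,f\,\cdot)$ on forms of degree $s$, so its kernel
consists of the apolar forms of that degree. -/
lemma catalecticant_mulVec {n s t : ℕ} (w : DualForm k n) (hn : s + t = n) (c : Fin (s + 1) → k)
    (i : Fin (t + 1)) : (catalecticant w s t 0).mulVec c i =
      extend w ((formOfCoeffs k s c : MvPolynomial (Fin 2) k) * (X 0 ^ (t - i : ℕ) * X 1 ^ (i : ℕ))) := by
  rw [coe_formOfCoeffs, Finset.sum_mul, map_sum, Matrix.mulVec, dotProduct]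
  refine Finset.sum_congr rfl fun j _ => ?_
  rw [mul_assoc, extend_C_mul, mul_comm (c j)]
  congr 1
  rw [catalecticant, Matrix.of_apply, coord]
  congr 1
  have h1 : n - (0 + (i : ℕ) + (j : ℕ)) = (s - j) + (t - i) := by omega
  rw [h1]
  ring

lemma mem_apolarIdeal_of_monomials {n d e : ℕ} {w : DualForm k n} (hn : d + e = n)
    {v : MvPolynomial (Fin 2) k} (hv : v.IsHomogeneous d)
    (h : ∀ i : Fin (e + 1), extend w (v * (X 0 ^ (e - i : ℕ) * X 1 ^ (i : ℕ))) = 0) :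
    v ∈ apolarIdeal w := by
  refine mem_apolarIdeal_of_forall_form hn hv fun u hu => ?_
  obtain ⟨c, hc⟩ := (formEquiv k e).surjective ⟨u, hu⟩
  have hc' : u = formOfCoeffs k e c := (congrArg Subtype.val hc).symm
  rw [hc', coe_formOfCoeffs, Finset.mul_sum, map_sum]
  refine Finset.sum_eq_zero fun i _ => ?_
  rw [mul_left_comm, extend_C_mul, h, mul_zero]

lemma rank_catalecticant_add {n s t : ℕ} (w : DualForm k n) (hn : s + t = n) :
    (catalecticant w s t 0).rank + Module.finrank k (apolarForms w s) = s + 1 := by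
  have h1 := LinearMap.finrank_range_add_finrank_ker (catalecticant w s t 0).mulVecLin
  rw [Module.finrank_fin_fun] at h1
  have h2 : LinearMap.ker (catalecticant w s t 0).mulVecLin =
      (apolarForms w s).comap (formEquiv k s).toLinearMap := by
    ext c
    rw [LinearMap.mem_ker, Submodule.mem_comap, mem_apolarForms]
    change _ ↔ (formOfCoeffs k s c : MvPolynomial (Fin 2) k) ∈ _
    constructor
    · intro h
      refine mem_apolarIdeal_of_monomials hn (formOfCoeffs k s c).2 fun i => ?_
      rw [← catalecticant_mulVec w hn]
      exact congrFun h i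
    · intro h
      ext i
      rw [Matrix.mulVecLin_apply, catalecticant_mulVec w hn]
      exact mem_apolarIdeal.mp h _
  rw [h2, LinearEquiv.finrank_eq ((formEquiv k s).ofSubmodule' (apolarForms w s))] at h1
  exact h1

lemma transpose_catalecticant {n s t : ℕ} (w : DualForm k n) :
    (catalecticant w s t 0).transpose = catalecticant w t s 0 := by
  ext i j
  simp [catalecticant, add_comm]

lemma catalecticantRank_add_cubics (w : DualForm k 5) :
    catalecticantRank w + Module.finrank k (apolarForms w 3) = 4 :=
  rank_catalecticant_add (s := 3) (t := 2) w rfl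

/-- Transposing the matrix exchanges the degrees 3 and 2, so one rank controls both apolar cubics
and apolar quadratics: rank 3 means no quadratic and one cubic up to scalars. -/
lemma catalecticantRank_add_quadrics (w : DualForm k 5) :
    catalecticantRank w + Module.finrank k (apolarForms w 2) = 3 := by
  have h : catalecticantRank w = (catalecticant w 2 3 0).rank := by
    rw [← transpose_catalecticant, Matrix.rank_transpose]
    rfl
  rw [h]
  exact rank_catalecticant_add (s := 2) (t := 3) w rfl

end

section

variable {k : Type*} [Field k]

/-! ### Pairs of independent linear forms -/

/-- The linear form `a x + b y`. -/
def lin (a b : k) : MvPolynomial (Fin 2) k := C a * X 0 + C b * X 1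

lemma isHomogeneous_lin (a b : k) : (lin a b).IsHomogeneous 1 :=
  (isHomogeneous_C_mul_X a 0).add (isHomogeneous_C_mul_X b 1)

lemma exists_eq_lin {f : MvPolynomial (Fin 2) k} (hf : f.IsHomogeneous 1) :
    ∃ a b, f = lin a b := by
  obtain ⟨c, hc⟩ := (formEquiv k 1).surjective ⟨f, hf⟩
  refine ⟨c 0, c 1, ?_⟩
  have := congrArg Subtype.val hc
  rw [formEquiv_apply, coe_formOfCoeffs] at this
  simpa [lin, Fin.sum_univ_two] using this.symm

lemma eval_lin (a b s t : k) : eval ![s, t] (lin a b) = a * s + b * t := by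
  simp [lin]

/-- Two linear forms `l = a x + b y` and `m = c x + d y` that are linearly independent. -/
structure Frame (k : Type*) [Field k] where
  /-- The coefficient of `x` in the first form. -/
  a : k
  /-- The coefficient of `y` in the first form. -/
  b : k
  /-- The coefficient of `x` in the second form. -/
  c : k
  /-- The coefficient of `y` in the second form. -/
  d : k
  det_ne_zero : a * d - b * c ≠ 0

namespace Frame

variable (F : Frame k)

/-- The determinant of a frame. -/
def det : k := F.a * F.d - F.b * F.c

/-- The first linear form of a frame. -/
def l : MvPolynomial (Fin 2) k := lin F.a F.b

/-- The second linear form of a frame. -/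
def m : MvPolynomial (Fin 2) k := lin F.c F.d

/-- The frame `x, y`. -/
def std (k : Type*) [Field k] : Frame k := ⟨1, 0, 0, 1, by simp⟩

/-- The frame with the two forms exchanged. -/
def swap : Frame k := ⟨F.c, F.d, F.a, F.b, fun h => F.det_ne_zero (by linear_combination -h)⟩

@[simp] lemma swap_l : F.swap.l = F.m := rfl
@[simp] lemma swap_m : F.swap.m = F.l := rfl

lemma isHomogeneous_l : F.l.IsHomogeneous 1 := isHomogeneous_lin _ _
lemma isHomogeneous_m : F.m.IsHomogeneous 1 := isHomogeneous_lin _ _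

lemma isHomogeneous_mul_pow (i j : ℕ) : (F.l ^ i * F.m ^ j).IsHomogeneous (i + j) := by
  simpa using (F.isHomogeneous_l.pow i).mul (F.isHomogeneous_m.pow j)

lemma eval_l_l : eval ![F.b, -F.a] F.l = 0 := by rw [l, eval_lin]; ring
lemma eval_l_m : eval ![F.b, -F.a] F.m = -F.det := by rw [m, eval_lin, det]; ring
lemma eval_m_l : eval ![F.d, -F.c] F.l = F.det := by rw [l, eval_lin, det]; ring
lemma eval_m_m : eval ![F.d, -F.c] F.m = 0 := by rw [m, eval_lin]; ring

lemma l_ne_zero : F.l ≠ 0 := fun h => F.det_ne_zero (by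
  have := F.eval_m_l
  rw [h, map_zero] at this
  exact this.symm)

lemma m_ne_zero : F.m ≠ 0 := F.swap.l_ne_zero

lemma irreducible_l : Irreducible F.l := irreducible_of_isHomogeneous_one F.isHomogeneous_l F.l_ne_zero
lemma irreducible_m : Irreducible F.m := irreducible_of_isHomogeneous_one F.isHomogeneous_m F.m_ne_zero

lemma not_l_dvd_m : ¬ F.l ∣ F.m := by
  rintro ⟨u, hu⟩
  have := F.eval_l_m
  rw [hu, map_mul, eval_l_l, zero_mul] at this
  exact F.det_ne_zero (neg_eq_zero.mp this.symm)

lemma exists_of_ne_zero {f : MvPolynomial (Fin 2) k} (hf : f.IsHomogeneous 1) (h0 : f ≠ 0) :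
    ∃ F : Frame k, F.l = f := by
  obtain ⟨a, b, rfl⟩ := exists_eq_lin hf
  by_cases ha : a = 0
  · have hb : b ≠ 0 := fun hb => h0 (by simp [lin, ha, hb])
    exact ⟨⟨a, b, 1, 0, by simpa using hb⟩, rfl⟩
  · exact ⟨⟨a, b, 0, 1, by simpa using ha⟩, rfl⟩

lemma exists_of_not_associated {f g : MvPolynomial (Fin 2) k} (hf : f.IsHomogeneous 1)
    (hg : g.IsHomogeneous 1) (hf0 : f ≠ 0) (hg0 : g ≠ 0) (h : ¬ Associated f g) :
    ∃ F : Frame k, F.l = f ∧ F.m = g := by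
  obtain ⟨a, b, rfl⟩ := exists_eq_lin hf
  obtain ⟨c, d, rfl⟩ := exists_eq_lin hg
  refine ⟨⟨a, b, c, d, fun hD => h ?_⟩, rfl, rfl⟩
  have hsmul : ∀ t : k, t ≠ 0 → lin c d = lin a b * C t → Associated (lin a b) (lin c d) :=
    fun t ht e => ⟨(IsUnit.mk0 t ht |>.map C).unit, by rw [e]; rfl⟩
  by_cases ha : a = 0
  · have hb : b ≠ 0 := fun hb => hf0 (by simp [lin, ha, hb])
    have hc : c = 0 := by simpa [ha, hb] using hD
    have hd : d ≠ 0 := fun hd => hg0 (by simp [lin, hc, hd])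
    refine hsmul (d / b) (div_ne_zero hd hb) ?_
    have : (C d : MvPolynomial (Fin 2) k) = C b * C (d / b) := by rw [← map_mul, mul_div_cancel₀ _ hb]
    rw [lin, lin, ha, hc, this]
    simp
    ring
  · have hd : d = b * (c / a) := by field_simp; linear_combination hD
    have hc : c ≠ 0 := fun hc => hg0 (by simp [lin, hc, hd])
    refine hsmul (c / a) (div_ne_zero hc ha) ?_
    have : (C c : MvPolynomial (Fin 2) k) = C a * C (c / a) := by rw [← map_mul, mul_div_cancel₀ _ ha]
    rw [lin, lin, this, hd, map_mul]
    ring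

lemma exists_expansion {n : ℕ} {f : MvPolynomial (Fin 2) k} (hf : f.IsHomogeneous n) :
    ∃ c : Fin (n + 1) → k, f = ∑ i : Fin (n + 1), C (c i) * (F.l ^ (n - i : ℕ) * F.m ^ (i : ℕ)) := by
  -- The inverse of the linear substitution $x\mapsto l$, $y\mapsto m$, by Cramer's rule.
  let r : Fin 2 → MvPolynomial (Fin 2) k :=
    ![lin (F.det⁻¹ * F.d) (-(F.det⁻¹ * F.b)), lin (-(F.det⁻¹ * F.c)) (F.det⁻¹ * F.a)]
  have hD : C F.det⁻¹ * C F.det = (1 : MvPolynomial (Fin 2) k) := by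
    rw [← map_mul, inv_mul_cancel₀ (show F.det ≠ 0 from F.det_ne_zero), map_one]
  have hD' : C F.det = (C F.a * C F.d - C F.b * C F.c : MvPolynomial (Fin 2) k) := by
    rw [det, map_sub, map_mul, map_mul]
  have hr : ∀ i, (r i).IsHomogeneous 1 := by
    intro i
    fin_cases i <;> exact isHomogeneous_lin _ _
  have hx : f = aeval ![F.l, F.m] (aeval r f) := by
    rw [← AlgHom.comp_apply, comp_aeval]
    conv_lhs => rw [← aeval_X_left_apply f]
    congr 2
    funext i
    fin_cases i
    · simp [r, lin, algHom_C, algebraMap_eq, l, m]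
      linear_combination (-X 0 : MvPolynomial (Fin 2) k) * hD + C F.det⁻¹ * X 0 * hD'
    · simp [r, lin, algHom_C, algebraMap_eq, l, m]
      linear_combination (-X 1 : MvPolynomial (Fin 2) k) * hD + C F.det⁻¹ * X 1 * hD'
  have hg : (aeval r f).IsHomogeneous n := by simpa using hf.aeval r hr
  obtain ⟨c, hc⟩ := (formEquiv k n).surjective ⟨_, hg⟩
  refine ⟨c, ?_⟩
  have h := congrArg Subtype.val hc
  rw [formEquiv_apply, coe_formOfCoeffs] at h
  rw [hx, show aeval r f = _ from h.symm, map_sum]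
  simp [algHom_C, algebraMap_eq]

lemma mem_apolarIdeal_iff {n d e : ℕ} {w : DualForm k n} (hn : d + e = n)
    {v : MvPolynomial (Fin 2) k} (hv : v.IsHomogeneous d) :
    v ∈ apolarIdeal w ↔ ∀ i ≤ e, extend w (v * (F.l ^ (e - i) * F.m ^ i)) = 0 := by
  refine ⟨fun h i _ => mem_apolarIdeal.mp h _, fun h =>
    mem_apolarIdeal_of_forall_form hn hv fun u hu => ?_⟩
  obtain ⟨c, rfl⟩ := F.exists_expansion hu
  rw [Finset.mul_sum, map_sum]
  refine Finset.sum_eq_zero fun i _ => ?_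
  rw [mul_left_comm, extend_C_mul, h _ (Nat.lt_succ_iff.mp i.2), mul_zero]

/-- The linear form `c₀ l + c₁ m`. -/
def linear (c₀ c₁ : k) : Form k 1 :=
  ⟨C c₀ * F.l + C c₁ * F.m, (F.isHomogeneous_l.C_mul c₀).add (F.isHomogeneous_m.C_mul c₁)⟩

/-- The quadratic form `c₀ l² + c₁ l m + c₂ m²`. -/
def quad (c₀ c₁ c₂ : k) : Form k 2 :=
  ⟨C c₀ * F.l ^ 2 + C c₁ * (F.l * F.m) + C c₂ * F.m ^ 2,
    (((F.isHomogeneous_l.pow 2).C_mul c₀).add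
      ((F.isHomogeneous_l.mul F.isHomogeneous_m).C_mul c₁)).add
      ((F.isHomogeneous_m.pow 2).C_mul c₂)⟩

lemma coe_linear (c₀ c₁ : k) :
    (F.linear c₀ c₁ : MvPolynomial (Fin 2) k) = C c₀ * F.l + C c₁ * F.m := rfl

lemma coe_quad (c₀ c₁ c₂ : k) : (F.quad c₀ c₁ c₂ : MvPolynomial (Fin 2) k) =
    C c₀ * F.l ^ 2 + C c₁ * (F.l * F.m) + C c₂ * F.m ^ 2 := rfl

lemma exists_eq_linear (f : Form k 1) : ∃ c₀ c₁, f = F.linear c₀ c₁ := by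
  obtain ⟨c, hc⟩ := F.exists_expansion f.2
  exact ⟨c 0, c 1, Subtype.ext (by simpa [Fin.sum_univ_two, -SetLike.coe_eq_coe, coe_linear] using hc)⟩

lemma exists_eq_quad (f : Form k 2) : ∃ c₀ c₁ c₂, f = F.quad c₀ c₁ c₂ := by
  obtain ⟨c, hc⟩ := F.exists_expansion f.2
  exact ⟨c 0, c 1, c 2, Subtype.ext (by simpa [Fin.sum_univ_three, -SetLike.coe_eq_coe, coe_quad] using hc)⟩

lemma linear_eq_zero {c₀ c₁ : k} : F.linear c₀ c₁ = 0 ↔ c₀ = 0 ∧ c₁ = 0 := by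
  constructor
  · intro h
    have h' := congrArg Subtype.val h
    rw [coe_linear] at h'
    have h0 := congrArg (eval ![F.d, -F.c]) h'
    have h1 := congrArg (eval ![F.b, -F.a]) h'
    simp only [map_add, map_mul, eval_C, eval_m_l, eval_m_m, eval_l_l, eval_l_m] at h0 h1
    simpa [show F.det ≠ 0 from F.det_ne_zero] using And.intro h0 h1
  · rintro ⟨rfl, rfl⟩
    exact Subtype.ext (by simp [coe_linear])

lemma quad_eq_zero {c₀ c₁ c₂ : k} : F.quad c₀ c₁ c₂ = 0 ↔ c₀ = 0 ∧ c₁ = 0 ∧ c₂ = 0 := by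
  constructor
  · intro h
    have h' := congrArg Subtype.val h
    rw [coe_quad] at h'
    have h0 := congrArg (eval ![F.d, -F.c]) h'
    have h1 := congrArg (eval ![F.b, -F.a]) h'
    simp only [map_add, map_mul, map_pow, eval_C, eval_m_l, eval_m_m, eval_l_l, eval_l_m] at h0 h1
    have h2 : c₀ = 0 ∧ c₂ = 0 := by
      simpa [show F.det ≠ 0 from F.det_ne_zero] using And.intro h0 h1
    obtain ⟨rfl, rfl⟩ := h2
    simpa [F.l_ne_zero, F.m_ne_zero] using h'
  · rintro ⟨rfl, rfl, rfl⟩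
    exact Subtype.ext (by simp [coe_quad])

lemma smul_linear (t c₀ c₁ : k) : t • F.linear c₀ c₁ = F.linear (t * c₀) (t * c₁) :=
  Subtype.ext (by simp only [Submodule.coe_smul, coe_linear, smul_eq_C_mul, map_mul]; ring)

lemma smul_quad (t c₀ c₁ c₂ : k) : t • F.quad c₀ c₁ c₂ = F.quad (t * c₀) (t * c₁) (t * c₂) :=
  Subtype.ext (by simp only [Submodule.coe_smul, coe_quad, smul_eq_C_mul, map_mul]; ring)

lemma linear_inj {c₀ c₁ d₀ d₁ : k} :
    F.linear c₀ c₁ = F.linear d₀ d₁ ↔ c₀ = d₀ ∧ c₁ = d₁ := by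
  rw [← sub_eq_zero, show F.linear c₀ c₁ - F.linear d₀ d₁ = F.linear (c₀ - d₀) (c₁ - d₁) from
    Subtype.ext (by simp only [AddSubgroupClass.coe_sub, coe_linear, map_sub]; ring),
    linear_eq_zero, sub_eq_zero, sub_eq_zero]

lemma quad_inj {c₀ c₁ c₂ d₀ d₁ d₂ : k} :
    F.quad c₀ c₁ c₂ = F.quad d₀ d₁ d₂ ↔ c₀ = d₀ ∧ c₁ = d₁ ∧ c₂ = d₂ := by
  rw [← sub_eq_zero, show F.quad c₀ c₁ c₂ - F.quad d₀ d₁ d₂ =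
    F.quad (c₀ - d₀) (c₁ - d₁) (c₂ - d₂) from
    Subtype.ext (by simp only [AddSubgroupClass.coe_sub, coe_quad, map_sub]; ring),
    quad_eq_zero, sub_eq_zero, sub_eq_zero, sub_eq_zero]

/-- A change of frame multiplies the discriminant by the square of the determinant, so its quadratic
character can be computed in any frame. -/
lemma quadDisc_quad (c₀ c₁ c₂ : k) :
    quadDisc (F.quad c₀ c₁ c₂) = F.det ^ 2 * (c₁ ^ 2 - 4 * c₀ * c₂) := by
  have h : ∀ A B E : k, quadDisc ((std k).quad A B E) = B ^ 2 - 4 * A * E := by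
    intro A B E
    have e : ((std k).quad A B E : MvPolynomial (Fin 2) k) =
        monomial (expo 2 0) A + monomial (expo 1 1) B + monomial (expo 0 2) E := by
      rw [← mul_one A, ← mul_one B, ← mul_one E]
      simp only [← C_mul_monomial, ← X_pow_mul_X_pow]
      simp [coe_quad, std, l, m, lin]
    have e1 : Finsupp.single 0 1 + Finsupp.single 1 1 = expo 1 1 := rfl
    have e0 : Finsupp.single 0 2 = expo 2 0 := by simp [expo]
    have e2 : Finsupp.single 1 2 = expo 0 2 := by simp [expo]
    rw [quadDisc, e, e1, e0, e2]
    simp [coeff_monomial, expo_inj]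
  have h2 : F.quad c₀ c₁ c₂ = (std k).quad
      (c₀ * F.a ^ 2 + c₁ * F.a * F.c + c₂ * F.c ^ 2)
      (2 * c₀ * F.a * F.b + c₁ * (F.a * F.d + F.b * F.c) + 2 * c₂ * F.c * F.d)
      (c₀ * F.b ^ 2 + c₁ * F.b * F.d + c₂ * F.d ^ 2) := by
    apply Subtype.ext
    simp only [coe_quad, std, l, m, lin, map_add, map_mul, map_pow, map_one, map_zero, map_ofNat]
    ring
  rw [h2, h, det]
  ring

end Frame

lemma quadDisc_smul (t : k) (f : Form k 2) : quadDisc (t • f) = t ^ 2 * quadDisc f := by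
  simp only [quadDisc, Submodule.coe_smul, coeff_smul, smul_eq_mul]
  ring

/-! ### Sums over the projective spaces of forms -/

namespace Frame

variable (F : Frame k)

lemma rep_mk_eq {V : Type*} [AddCommGroup V] [Module k V] (v : V) (hv : v ≠ 0) :
    ∃ t : k, t ≠ 0 ∧ (Projectivization.mk k v hv).rep = t • v := by
  obtain ⟨a, ha⟩ := Projectivization.exists_smul_eq_mk_rep k v hv
  exact ⟨a, a.ne_zero, ha.symm⟩

/-- Each projective point has exactly one representative whose last nonzero coordinate in the frame
is 1; `sum_quad` uses the same normalization. -/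
lemma sum_linear {A : Type*} [AddCommMonoid A] [Fintype k] (G : Form k 1 → A)
    (hG : ∀ (t : k) f, t ≠ 0 → G (t • f) = G f) :
    ∑ P : ℙ k (Form k 1), G P.rep = G (F.linear 1 0) + ∑ t, G (F.linear t 1) := by
  let v : Option k → Form k 1 := fun o => o.elim (F.linear 1 0) fun t => F.linear t 1
  have hv : ∀ o, v o ≠ 0 := by
    rintro (_ | t) h <;> simpa using F.linear_eq_zero.mp h
  have hb : Function.Bijective fun o => Projectivization.mk k (v o) (hv o) := by
    constructor
    · intro o o' h
      obtain ⟨a, ha⟩ := (Projectivization.mk_eq_mk_iff' _ _ _ _ _).mp h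
      rcases o with _ | t <;> rcases o' with _ | t' <;>
        simp only [v, Option.elim, smul_linear, linear_inj] at ha <;> grind
    · refine Projectivization.ind (K := k) fun f hf => ?_
      obtain ⟨c₀, c₁, rfl⟩ := F.exists_eq_linear f
      by_cases h : c₁ = 0
      · subst h
        refine ⟨none, (Projectivization.mk_eq_mk_iff' _ _ _ _ _).mpr ⟨c₀⁻¹, ?_⟩⟩
        have : c₀ ≠ 0 := fun e => hf (F.linear_eq_zero.mpr ⟨e, rfl⟩)
        simp [v, smul_linear, this]
      · refine ⟨some (c₀ / c₁), (Projectivization.mk_eq_mk_iff' _ _ _ _ _).mpr ⟨c₁⁻¹, ?_⟩⟩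
        simp [v, smul_linear, h, div_eq_inv_mul]
  have hrep : ∀ o, G (Projectivization.mk k (v o) (hv o)).rep = G (v o) := fun o => by
    obtain ⟨t, ht, e⟩ := rep_mk_eq (k := k) (v o) (hv o)
    rw [e, hG t _ ht]
  rw [← hb.sum_comp, Fintype.sum_option]
  simp only [hrep]
  rfl

lemma sum_quad {A : Type*} [AddCommMonoid A] [Fintype k] (G : Form k 2 → A)
    (hG : ∀ (t : k) f, t ≠ 0 → G (t • f) = G f) :
    ∑ P : ℙ k (Form k 2), G P.rep =
      G (F.quad 1 0 0) + ∑ t, G (F.quad t 1 0) + ∑ s, ∑ t, G (F.quad t s 1) := by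
  let v : Option k ⊕ k × k → Form k 2 := Sum.elim
    (fun o => o.elim (F.quad 1 0 0) fun t => F.quad t 1 0) fun st => F.quad st.2 st.1 1
  have hv : ∀ o, v o ≠ 0 := by
    rintro ((_ | t) | st) h <;> simpa using F.quad_eq_zero.mp h
  have hb : Function.Bijective fun o => Projectivization.mk k (v o) (hv o) := by
    constructor
    · intro o o' h
      obtain ⟨a, ha⟩ := (Projectivization.mk_eq_mk_iff' _ _ _ _ _).mp h
      rcases o with (_ | t) | ⟨s, t⟩ <;> rcases o' with (_ | t') | ⟨s', t'⟩ <;>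
        simp only [v, Option.elim, Sum.elim_inl, Sum.elim_inr, smul_quad, quad_inj] at ha <;> grind
    · refine Projectivization.ind (K := k) fun f hf => ?_
      obtain ⟨c₀, c₁, c₂, rfl⟩ := F.exists_eq_quad f
      by_cases h : c₂ = 0
      · subst h
        by_cases h1 : c₁ = 0
        · subst h1
          refine ⟨.inl none, (Projectivization.mk_eq_mk_iff' _ _ _ _ _).mpr ⟨c₀⁻¹, ?_⟩⟩
          have : c₀ ≠ 0 := fun e => hf (F.quad_eq_zero.mpr ⟨e, rfl, rfl⟩)
          simp [v, smul_quad, this]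
        · refine ⟨.inl (some (c₀ / c₁)), (Projectivization.mk_eq_mk_iff' _ _ _ _ _).mpr ⟨c₁⁻¹, ?_⟩⟩
          simp [v, smul_quad, h1, div_eq_inv_mul]
      · refine ⟨.inr (c₁ / c₂, c₀ / c₂), (Projectivization.mk_eq_mk_iff' _ _ _ _ _).mpr ⟨c₂⁻¹, ?_⟩⟩
        simp [v, smul_quad, h, div_eq_inv_mul]
  have hrep : ∀ o, G (Projectivization.mk k (v o) (hv o)).rep = G (v o) := fun o => by
    obtain ⟨t, ht, e⟩ := rep_mk_eq (k := k) (v o) (hv o)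
    rw [e, hG t _ ht]
  rw [← hb.sum_comp, Fintype.sum_sum_type, Fintype.sum_option, Fintype.sum_prod_type]
  simp only [hrep]
  rfl

end Frame

end

section

variable {k : Type*} [Field k]

/-! ### Squares dividing a form -/

lemma le_of_dvd {f g : MvPolynomial (Fin 2) k} {i j : ℕ} (hf : f.IsHomogeneous i)
    (hg : g.IsHomogeneous j) (h0 : g ≠ 0) (h : f ∣ g) : i ≤ j := by
  obtain ⟨u, rfl⟩ := h
  obtain ⟨i', j', hij, hi, -⟩ := exists_isHomogeneous_of_mul hg h0
  have := hi.inj_right hf (left_ne_zero_of_mul h0)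
  omega

/-- Take $g$ of largest degree with $g^2\mid v$. If $f^2\mid v$, write $f=da$ and $g=db$ with $a,b$
relatively prime. Then $a^2$ divides $v/g^2$, so $(ga)^2\mid v$, and maximality forces $a$ to be
constant. -/
lemma exists_square_root_of_square_part {v : MvPolynomial (Fin 2) k} {N : ℕ}
    (hv : v.IsHomogeneous N) (h0 : v ≠ 0) :
    ∃ n, ∃ g : MvPolynomial (Fin 2) k, 2 * n ≤ N ∧ g.IsHomogeneous n ∧ g ≠ 0 ∧
      ∀ f, f ^ 2 ∣ v ↔ f ∣ g := by
  classical
  let P : ℕ → Prop := fun j => ∃ g : MvPolynomial (Fin 2) k, g.IsHomogeneous j ∧ g ^ 2 ∣ v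
  obtain ⟨g, hg, u, hu⟩ : P (Nat.findGreatest P N) :=
    Nat.findGreatest_spec (Nat.zero_le N) ⟨1, isHomogeneous_one _ _, by simp⟩
  have hmax : ∀ j, P j → j ≤ Nat.findGreatest P N := by
    rintro j ⟨f, hf, hfv⟩
    refine Nat.le_findGreatest ?_ ⟨f, hf, hfv⟩
    have := le_of_dvd (hf.pow 2) hv h0 hfv
    omega
  have hg0 : g ≠ 0 := by
    rintro rfl
    exact h0 (by simpa using hu)
  refine ⟨_, g, ?_, hg, hg0, fun f => ⟨fun hf => ?_, fun hf => (pow_dvd_pow_of_dvd hf 2).trans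
    ⟨u, hu⟩⟩⟩
  · have := le_of_dvd (hg.pow 2) hv h0 ⟨u, hu⟩
    omega
  · have hf0 : f ≠ 0 := by
      rintro rfl
      exact h0 (by simpa using hf)
    obtain ⟨a, b, d, hab, rfl, rfl⟩ := UniqueFactorizationMonoid.exists_reduced_factors f hf0 g
    have hd0 : d ≠ 0 := left_ne_zero_of_mul hf0
    have h1 : a ^ 2 ∣ u := by
      rw [hu, mul_pow, mul_pow, mul_assoc] at hf
      exact (hab.pow (m := 2) (n := 2)).dvd_of_dvd_mul_left
        ((mul_dvd_mul_iff_left (pow_ne_zero 2 hd0)).mp hf)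
    have h2 : (d * b * a) ^ 2 ∣ v := by
      rw [hu, mul_pow]
      exact mul_dvd_mul_left _ h1
    have h3 : (d * b * a) ^ 2 ≠ 0 := fun e => h0 (by rw [e] at h2; exact zero_dvd_iff.mp h2)
    obtain ⟨s, hs⟩ := h2
    obtain ⟨i, j, -, hi, -⟩ := exists_isHomogeneous_of_mul (hs ▸ hv) (hs ▸ h0)
    rw [pow_two] at hi h3
    obtain ⟨i', j', -, hi', -⟩ := exists_isHomogeneous_of_mul hi h3
    obtain ⟨i'', j'', hij, hi'', hj''⟩ := exists_isHomogeneous_of_mul hi' (left_ne_zero_of_mul h3)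
    have h4 := hmax i' ⟨_, hi', s, hs⟩
    have h5 := hi''.inj_right hg hg0
    obtain rfl : j'' = 0 := by omega
    exact mul_dvd_mul_left d
      (isUnit_of_isHomogeneous_zero hj'' (right_ne_zero_of_mul hf0)).dvd

lemma coe_rep_ne_zero {n : ℕ} (P : ℙ k (Form k n)) : (P.rep : MvPolynomial (Fin 2) k) ≠ 0 := by
  simpa using P.rep_nonzero

lemma rep_dvd_iff {n : ℕ} (P : ℙ k (Form k n)) {g : Form k n} (hg : g ≠ 0) :
    (P.rep : MvPolynomial (Fin 2) k) ∣ g ↔ P = Projectivization.mk k g hg := by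
  rw [dvd_iff_mk_eq P.rep_nonzero hg, P.mk_rep]

lemma smul_dvd_iff {n : ℕ} {t : k} (ht : t ≠ 0) (f : Form k n) (g : MvPolynomial (Fin 2) k) :
    ((t • f : Form k n) : MvPolynomial (Fin 2) k) ∣ g ↔ (f : MvPolynomial (Fin 2) k) ∣ g := by
  rw [Submodule.coe_smul, smul_eq_C_mul]
  exact ((IsUnit.mk0 t ht).map C).mul_left_dvd

lemma isSingular_iff {v g : MvPolynomial (Fin 2) k} {n : ℕ} (hg : g.IsHomogeneous n) (hg0 : g ≠ 0)
    (h : ∀ f, f ^ 2 ∣ v ↔ f ∣ g) : IsSingular v ↔ n ≠ 0 := by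
  simp only [IsSingular, h]
  constructor
  · rintro ⟨f, hf, hfg⟩ rfl
    exact hf (isUnit_of_dvd_unit hfg (isUnit_of_isHomogeneous_zero hg hg0))
  · intro hn
    refine ⟨g, fun hu => hn (hg.inj_right (isHomogeneous_zero_of_isUnit hu) hg0), dvd_rfl⟩

/-! ### Zeros of quadratic forms and Möbius inversion over a finite field -/

variable [Fintype k] [DecidableEq k]

lemma quadraticChar_quadDisc_smul {t : k} (ht : t ≠ 0) (f : Form k 2) :
    quadraticChar k (quadDisc (t • f)) = quadraticChar k (quadDisc f) := by
  rw [quadDisc_smul, map_mul, quadraticChar_sq_one' ht, one_mul]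

lemma sum_quadraticChar_sub_four_mul (hk : ringChar k ≠ 2) (D : k) :
    ∑ t : k, quadraticChar k (D - 4 * t) = 0 := by
  have h4 : (4 : k) ≠ 0 := by
    rw [show (4 : k) = 2 * 2 by norm_num]
    exact mul_ne_zero (Ring.two_ne_zero hk) (Ring.two_ne_zero hk)
  rw [← quadraticChar_sum_zero hk]
  exact Fintype.sum_equiv ((Equiv.mulLeft₀ 4 h4).trans (Equiv.subLeft D)) _ _ fun t => rfl

/-- The number of zeros of a binary quadratic form in the projective line. -/
lemma card_zeros_quadratic (hk : ringChar k ≠ 2) (A B E : k) (h : ¬ (A = 0 ∧ B = 0 ∧ E = 0)) :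
    (if E = 0 then 1 else 0) + ∑ t : k, (if E * t ^ 2 - B * t + A = 0 then 1 else 0 : ℤ) =
      1 + quadraticChar k (B ^ 2 - 4 * A * E) := by
  have h2 := Ring.two_ne_zero hk
  by_cases hE : E = 0
  · subst hE
    simp only [if_true, mul_zero, zero_mul, sub_zero, zero_sub]
    congr 1
    by_cases hB : B = 0
    · subst hB
      have hA : A ≠ 0 := fun e => h ⟨e, rfl, rfl⟩
      simp [hA]
    · rw [quadraticChar_sq_one' hB, Finset.sum_eq_single (A / B)]
      · rw [if_pos (by field_simp; ring)]
      · intro t _ ht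
        rw [if_neg]
        intro e
        exact ht (by field_simp; linear_combination -e)
      · simp
  · have := quadraticChar_card_sqrts hk (B ^ 2 - 4 * A * E)
    rw [if_neg hE, zero_add, add_comm, ← this, Finset.card_eq_sum_ones, Set.toFinset_ofPred,
      Finset.sum_filter]
    push_cast
    -- Completing the square, $4E(Et^2-Bt+A)=(2Et-B)^2-(B^2-4AE)$: the map $t\mapsto 2Et-B$ carries
    -- roots to square roots of the discriminant.
    refine Fintype.sum_equiv ((Equiv.mulLeft₀ (2 * E) (mul_ne_zero h2 hE)).trans
      (Equiv.subRight B)) _ _ fun t => ?_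
    refine if_congr ?_ rfl rfl
    change _ ↔ (2 * E * t - B) ^ 2 = _
    constructor
    · intro e
      linear_combination 4 * E * e
    · intro e
      have : 4 * E * (E * t ^ 2 - B * t + A) = 0 := by linear_combination e
      rcases mul_eq_zero.mp this with h' | h'
      · rw [show 4 * E = 2 * (2 * E) by ring] at h'
        simp [h2, hE] at h'
      · exact h'

open scoped Classical in
-- A linear form divides $g$ when $g$ vanishes at its zero. The form $x$ vanishes at $(0,1)$ and
-- $tx+y$ at $(1,-t)$, which produces the two terms of `card_zeros_quadratic`.
lemma sum_linear_dvd_quadratic (hk : ringChar k ≠ 2) {g : Form k 2} (hg : g ≠ 0) :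
    ∑ P : ℙ k (Form k 1), (if (P.rep : MvPolynomial (Fin 2) k) ∣ g then 1 else 0 : ℤ) =
      1 + quadraticChar k (quadDisc g) := by
  rw [(Frame.std k).sum_linear (fun f => (if (f : MvPolynomial (Fin 2) k) ∣ g then 1 else 0 : ℤ))
    fun t f ht => by simp only [smul_dvd_iff ht]]
  obtain ⟨A, B, E, rfl⟩ := (Frame.std k).exists_eq_quad g
  rw [Frame.quadDisc_quad, show (Frame.std k).det = 1 by simp [Frame.det, Frame.std], one_pow,
    one_mul, ← card_zeros_quadratic hk A B E (fun h => hg ((Frame.std k).quad_eq_zero.mpr h))]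
  have hl : (Frame.std k).l = X 0 := by simp [Frame.l, Frame.std, lin]
  have hm : (Frame.std k).m = X 1 := by simp [Frame.m, Frame.std, lin]
  congr 1
  · refine if_congr ?_ rfl rfl
    rw [Frame.coe_linear, Frame.coe_quad, hl, hm]
    constructor
    · rintro ⟨u, hu⟩
      simpa using congrArg (eval ![0, 1]) hu
    · rintro rfl
      exact ⟨C A * X 0 + C B * X 1, by simp only [map_one, map_zero]; ring⟩
  · refine Finset.sum_congr rfl fun t _ => if_congr ?_ rfl rfl
    rw [Frame.coe_linear, Frame.coe_quad, hl, hm]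
    constructor
    · rintro ⟨u, hu⟩
      have := congrArg (eval ![1, -t]) hu
      simp at this
      linear_combination this
    · intro e
      refine ⟨C E * X 1 + C (B - E * t) * X 0, ?_⟩
      have e' := congrArg (C : k →+* MvPolynomial (Fin 2) k) e
      simp only [map_add, map_sub, map_mul, map_pow, map_zero, map_one] at e' ⊢
      linear_combination X 0 ^ 2 * e'

open scoped Classical in
/-- Möbius inversion for the indicator function of the singular binary quintics. -/
lemma indicator_isSingular (hk : ringChar k ≠ 2) (v : Form k 5) :
    (if IsSingular (v : MvPolynomial (Fin 2) k) then 1 else 0 : ℤ) =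
      ∑ P : ℙ k (Form k 1), (if (P.rep : MvPolynomial (Fin 2) k) ^ 2 ∣ v then 1 else 0) -
      ∑ P : ℙ k (Form k 2), (if (P.rep : MvPolynomial (Fin 2) k) ^ 2 ∣ v then
        quadraticChar k (quadDisc P.rep) else 0) := by
  by_cases hv : v = 0
  · subst hv
    rw [if_pos ⟨0, not_isUnit_zero, by simp⟩]
    simp only [ZeroMemClass.coe_zero, dvd_zero, if_true]
    -- Every square divides $0$. The first sum is $\#k+1$ and the second is $\#k$, the latter coming
    -- from the forms $tx^2+xy$ of discriminant 1.
    rw [(Frame.std k).sum_linear (fun _ => (1 : ℤ)) (fun _ _ _ => rfl),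
      (Frame.std k).sum_quad (fun f => quadraticChar k (quadDisc f))
        fun t f ht => quadraticChar_quadDisc_smul ht f]
    simp [-quadraticChar_apply, MulChar.map_zero, Frame.quadDisc_quad,
      show (Frame.std k).det = 1 by simp [Frame.det, Frame.std],
      sum_quadraticChar_sub_four_mul hk]
  · obtain ⟨n, g, hn, hg, hg0, h⟩ := exists_square_root_of_square_part v.2 (by simpa using hv)
    simp only [isSingular_iff hg hg0 h, h]
    have hdeg : ∀ d, n < d → ∀ P : ℙ k (Form k d), ¬ (P.rep : MvPolynomial (Fin 2) k) ∣ g :=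
      fun d hd P hP => absurd (le_of_dvd P.rep.2 hg hg0 hP) (by omega)
    -- Since $2n\le5$, three degrees remain: the right side is $0-0$, then $1-0$, then
    -- $(1+\chi(\operatorname{Disc} g))-\chi(\operatorname{Disc} g)$.
    obtain rfl | rfl | rfl : n = 0 ∨ n = 1 ∨ n = 2 := by omega
    · simp [hdeg 1 one_pos, hdeg 2 two_pos]
    · have := fun P => rep_dvd_iff P (g := (⟨g, hg⟩ : Form k 1)) (by simpa [Subtype.ext_iff] using hg0)
      simp only at this
      simp [hdeg 2 one_lt_two, this]
    · have hg0' : (⟨g, hg⟩ : Form k 2) ≠ 0 := by simpa [Subtype.ext_iff] using hg0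
      have h1 := sum_linear_dvd_quadratic hk hg0'
      have h2 := fun P => rep_dvd_iff P hg0'
      simp only at h1 h2
      rw [h1]
      simp only [h2]
      obtain ⟨t, ht, e⟩ := Frame.rep_mk_eq (k := k) (⟨g, hg⟩ : Form k 2) hg0'
      simp [-quadraticChar_apply, e, quadraticChar_quadDisc_smul ht]

end

section

/-! ### The Fourier transform -/

lemma singularExpSum_eq_stdAddChar {p : ℕ} [Fact p.Prime] {n : ℕ} (w : DualForm (ZMod p) n) :
    singularExpSum w = (1 / (Fintype.card (Form (ZMod p) n) : ℂ)) *
      ∑ v : Form (ZMod p) n, (((open scoped Classical in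
        if IsSingular (v : MvPolynomial (Fin 2) (ZMod p)) then 1 else 0 : ℤ) : ℂ)) *
        ZMod.stdAddChar (w v) := by
  rw [singularExpSum]
  congr 1
  refine Finset.sum_congr rfl fun v _ => ?_
  congr 1
  · push_cast
    rfl
  · have := ZMod.stdAddChar_coe (N := p) ((w v).val : ℤ)
    simp only [Int.cast_natCast, ZMod.natCast_zmod_val] at this
    rw [this]

section
variable {p : ℕ} [Fact p.Prime]

open scoped Classical in
lemma sum_stdAddChar_linear {e : ℕ} (L : Form (ZMod p) e →ₗ[ZMod p] ZMod p) :
    ∑ u, (ZMod.stdAddChar (L u) : ℂ) = if L = 0 then (p : ℂ) ^ (e + 1) else 0 := by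
  have h := AddChar.sum_eq_ite
    ((ZMod.stdAddChar (N := p)).compAddMonoidHom L.toAddMonoidHom)
  have hL : (ZMod.stdAddChar (N := p)).compAddMonoidHom L.toAddMonoidHom = 0 ↔ L = 0 := by
    constructor
    · intro h0
      ext u
      have := DFunLike.congr_fun h0 u
      exact ZMod.injective_stdAddChar (this.trans (AddChar.map_zero_eq_one (ZMod.stdAddChar (N := p))).symm)
    · rintro rfl
      ext u
      exact AddChar.map_zero_eq_one (ZMod.stdAddChar (N := p))
  simp only [hL, card_form, ZMod.card, Nat.cast_pow] at h
  exact h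

lemma exists_eq_mul_of_dvd {k : Type*} [Field k] {d e n : ℕ} (hn : d + e = n)
    {g : MvPolynomial (Fin 2) k} (hg : g.IsHomogeneous d) (hg0 : g ≠ 0) (v : Form k n)
    (h : g ∣ v) : ∃ u : Form k e, g * u = v := by
  by_cases hv : (v : MvPolynomial (Fin 2) k) = 0
  · exact ⟨0, by simp [hv]⟩
  · obtain ⟨u, hu⟩ := h
    have hv' := v.2
    rw [hu] at hv hv'
    obtain ⟨i, j, hij, hi, hj⟩ := exists_isHomogeneous_of_mul hv' hv
    have := hi.inj_right hg hg0
    obtain rfl : j = e := by omega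
    exact ⟨⟨u, hj⟩, hu.symm⟩

lemma exists_functional_extend_mul {k : Type*} [Field k] {n : ℕ} (w : DualForm k n)
    (g : MvPolynomial (Fin 2) k) (e : ℕ) :
    ∃ L : Form k e →ₗ[k] k, ∀ u, L u = extend w (g * u) :=
  ⟨polar w g ∘ₗ (Form k e).subtype, fun _ => rfl⟩

open scoped Classical in
-- The multiples of $g$ of degree $n$ are the $gu$ with $u$ of degree $e$. The sum over $u$ of the
-- character of the linear functional $u\mapsto(w,gu)$ is zero unless this functional vanishes, that
-- is, unless $g$ is apolar.
lemma sum_stdAddChar_of_dvd {n d e : ℕ} (hn : d + e = n) (w : DualForm (ZMod p) n)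
    {g : MvPolynomial (Fin 2) (ZMod p)} (hg : g.IsHomogeneous d) (hg0 : g ≠ 0) :
    ∑ v : Form (ZMod p) n, (if g ∣ (v : MvPolynomial (Fin 2) (ZMod p)) then
      (ZMod.stdAddChar (w v) : ℂ) else 0) =
      if g ∈ apolarIdeal w then (p : ℂ) ^ (e + 1) else 0 := by
  have hom : ∀ u : Form (ZMod p) e,
      (g * (u : MvPolynomial (Fin 2) (ZMod p))).IsHomogeneous n := fun u => hn ▸ hg.mul u.2
  obtain ⟨L, hLu⟩ := exists_functional_extend_mul w g e
  have hL : L = 0 ↔ g ∈ apolarIdeal w := by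
    constructor
    · intro h
      refine mem_apolarIdeal_of_forall_form hn hg fun u hu => ?_
      rw [← hLu ⟨u, hu⟩, h, LinearMap.zero_apply]
    · intro h
      refine LinearMap.ext fun u => ?_
      rw [hLu, LinearMap.zero_apply]
      exact mem_apolarIdeal.mp h u
  simp only [← hL]
  rw [← sum_stdAddChar_linear L, ← Finset.sum_filter]
  refine (Finset.sum_bij (fun (u : Form (ZMod p) e) _ => (⟨_, hom u⟩ : Form (ZMod p) n))
    ?_ ?_ ?_ ?_).symm
  · intro u _
    exact Finset.mem_filter.mpr ⟨Finset.mem_univ _, dvd_mul_right _ _⟩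
  · intro u _ u' _ h
    exact Subtype.ext (mul_left_cancel₀ hg0 (congrArg Subtype.val h))
  · intro v hv
    obtain ⟨u, hu⟩ := exists_eq_mul_of_dvd hn hg hg0 v (Finset.mem_filter.mp hv).2
    exact ⟨u, Finset.mem_univ _, Subtype.ext hu⟩
  · intro u _
    rw [hLu, ← extend_coe]

open scoped Classical in
/-- The number of points `[l]` of the projective line of linear forms with `l²` apolar to `w`. -/
def numSquares {n : ℕ} (w : DualForm (ZMod p) n) : ℕ :=
  ∑ P : ℙ (ZMod p) (Form (ZMod p) 1),
    if (P.rep : MvPolynomial (Fin 2) (ZMod p)) ^ 2 ∈ apolarIdeal w then 1 else 0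

open scoped Classical in
lemma legendreSum_eq {n : ℕ} (w : DualForm (ZMod p) n) :
    legendreSum w = - ∑ P : ℙ (ZMod p) (Form (ZMod p) 2),
      if (P.rep : MvPolynomial (Fin 2) (ZMod p)) ^ 2 ∈ apolarIdeal w then
        quadraticChar (ZMod p) (quadDisc P.rep) else 0 := by
  rw [legendreSum, Finset.sum_filter]

/-- The cofactors of $l^2$ have degree 3 and those of $f^2$ degree 1. This gives $p^4$ and $p^2$, to
be divided by the number $p^6$ of quintics. -/
lemma singularExpSum_eq (hp : 2 < p) (w : DualForm (ZMod p) 5) :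
    singularExpSum w =
      (numSquares w : ℂ) * (p : ℂ) ^ (-2 : ℤ) + (legendreSum w : ℂ) * (p : ℂ) ^ (-4 : ℤ) := by
  classical
  have hk : ringChar (ZMod p) ≠ 2 := by
    rw [ZMod.ringChar_zmod_n]
    omega
  have hp0 : (p : ℂ) ≠ 0 := Nat.cast_ne_zero.mpr (by omega)
  have key : ∑ v : Form (ZMod p) 5, ((
        (if IsSingular (v : MvPolynomial (Fin 2) (ZMod p)) then 1 else 0 : ℤ) : ℂ)) *
        (ZMod.stdAddChar (w v) : ℂ) =
      (numSquares w : ℂ) * (p : ℂ) ^ 4 + (legendreSum w : ℂ) * (p : ℂ) ^ 2 := by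
    simp only [indicator_isSingular hk]
    push_cast
    simp only [sub_mul, Finset.sum_mul, Finset.sum_sub_distrib]
    rw [Finset.sum_comm, Finset.sum_comm (s := Finset.univ (α := Form (ZMod p) 5))
      (t := Finset.univ (α := ℙ (ZMod p) (Form (ZMod p) 2))), legendreSum_eq, numSquares]
    push_cast
    rw [neg_mul, ← sub_eq_add_neg, Finset.sum_mul, Finset.sum_mul]
    congr 1
    · refine Finset.sum_congr rfl fun P _ => ?_
      have := sum_stdAddChar_of_dvd (e := 3) rfl w (IsHomogeneous.pow P.rep.2 2)
        (pow_ne_zero 2 (coe_rep_ne_zero P))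
      simp only [ite_mul, one_mul, zero_mul]
      exact this
    · refine Finset.sum_congr rfl fun P _ => ?_
      have := sum_stdAddChar_of_dvd (e := 1) rfl w (IsHomogeneous.pow P.rep.2 2)
        (pow_ne_zero 2 (coe_rep_ne_zero P))
      have h2 := congrArg (fun z : ℂ => (quadraticChar (ZMod p) (quadDisc P.rep) : ℂ) * z) this
      simp only [Finset.mul_sum, mul_ite, mul_zero] at h2
      simp only [ite_mul, zero_mul]
      exact h2
  rw [singularExpSum_eq_stdAddChar, key, card_form, ZMod.card]
  simp only [zpow_neg]
  norm_cast
  push_cast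
  field_simp

end

end

section

variable {k : Type*} [Field k]

/-! ### Splitting types -/

lemma hasSplittingType_singleton {f : MvPolynomial (Fin 2) k} {d e : ℕ} :
    HasSplittingType f {(d, e)} ↔ ∃ g, Irreducible g ∧ g.IsHomogeneous d ∧ 1 ≤ e ∧
      Associated f (g ^ e) := by
  constructor
  · rintro ⟨r, g, d', e', h1, -, h3, h4⟩
    have hr := congrArg Multiset.card h4
    simp only [Multiset.card_singleton, Multiset.card_map, Finset.card_val, Finset.card_univ,
      Fintype.card_fin] at hr
    subst hr
    have h5 : d = d' 0 ∧ e = e' 0 := by simpa using h4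
    obtain ⟨rfl, rfl⟩ := h5
    exact ⟨g 0, (h1 0).1, (h1 0).2.1, (h1 0).2.2, by simpa using h3⟩
  · rintro ⟨g, h1, h2, h3, h4⟩
    refine ⟨1, fun _ => g, fun _ => d, fun _ => e, fun _ => ⟨h1, h2, h3⟩, fun i j hij => ?_, ?_, ?_⟩
    · exact absurd (Subsingleton.elim i j) hij
    · simpa using h4
    · simp

lemma hasSplittingType_pair {f : MvPolynomial (Fin 2) k} {d₁ e₁ d₂ e₂ : ℕ} :
    HasSplittingType f {(d₁, e₁), (d₂, e₂)} ↔ ∃ g₁ g₂, (Irreducible g₁ ∧ g₁.IsHomogeneous d₁) ∧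
      (Irreducible g₂ ∧ g₂.IsHomogeneous d₂) ∧ 1 ≤ e₁ ∧ 1 ≤ e₂ ∧ ¬ Associated g₁ g₂ ∧
      Associated f (g₁ ^ e₁ * g₂ ^ e₂) := by
  constructor
  · rintro ⟨r, g, d', e', h1, h2, h3, h4⟩
    have hr := congrArg Multiset.card h4
    simp only [Multiset.insert_eq_cons, Multiset.card_cons, Multiset.card_singleton,
      Multiset.card_map, Finset.card_val, Finset.card_univ, Fintype.card_fin] at hr
    subst hr
    have h5 : (((d₁, e₁) ::ₘ {(d₂, e₂)} : Multiset (ℕ × ℕ))) =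
        (d' 0, e' 0) ::ₘ {(d' 1, e' 1)} := by
      rw [← Multiset.insert_eq_cons, h4]
      rfl
    rw [Fin.prod_univ_two] at h3
    have h6 : (d₁ = d' 0 ∧ e₁ = e' 0) ∧ (d₂ = d' 1 ∧ e₂ = e' 1) ∨
        (d₁ = d' 1 ∧ e₁ = e' 1) ∧ (d₂ = d' 0 ∧ e₂ = e' 0) := by
      rcases Multiset.cons_eq_cons.mp h5 with ⟨h, h'⟩ | ⟨-, cs, h, h'⟩
      · simp only [Multiset.singleton_inj, Prod.mk.injEq] at h h'
        exact Or.inl ⟨h, h'⟩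
      · have hc : cs = 0 := by
          have := congrArg Multiset.card h
          simp only [Multiset.card_singleton, Multiset.card_cons] at this
          exact Multiset.card_eq_zero.mp (by omega)
        subst hc
        simp only [Multiset.cons_zero, Multiset.singleton_inj, Prod.mk.injEq] at h h'
        exact Or.inr ⟨⟨h'.1.symm, h'.2.symm⟩, h⟩
    rcases h6 with ⟨⟨rfl, rfl⟩, ⟨rfl, rfl⟩⟩ | ⟨⟨rfl, rfl⟩, ⟨rfl, rfl⟩⟩
    · exact ⟨g 0, g 1, ⟨(h1 0).1, (h1 0).2.1⟩, ⟨(h1 1).1, (h1 1).2.1⟩, (h1 0).2.2, (h1 1).2.2,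
        h2 0 1 (by simp), h3⟩
    · exact ⟨g 1, g 0, ⟨(h1 1).1, (h1 1).2.1⟩, ⟨(h1 0).1, (h1 0).2.1⟩, (h1 1).2.2, (h1 0).2.2,
        h2 1 0 (by simp), mul_comm (g 0 ^ e' 0) _ ▸ h3⟩
  · rintro ⟨g₁, g₂, h1, h2, he1, he2, h3, h4⟩
    refine ⟨2, ![g₁, g₂], ![d₁, d₂], ![e₁, e₂], ?_, ?_, ?_, rfl⟩
    · intro i
      fin_cases i
      · exact ⟨h1.1, h1.2, he1⟩
      · exact ⟨h2.1, h2.2, he2⟩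
    · intro i j hij
      fin_cases i <;> fin_cases j
      · exact absurd rfl hij
      · exact h3
      · exact fun h => h3 h.symm
      · exact absurd rfl hij
    · simpa [Fin.prod_univ_two] using h4

lemma mem_ideal_of_associated {R : Type*} [CommRing R] {I : Ideal R} {f g : R}
    (h : Associated f g) (hf : f ∈ I) : g ∈ I := by
  obtain ⟨u, rfl⟩ := h
  exact I.mul_mem_right _ hf

section
variable {n : ℕ} {w : DualForm k n}

lemma hasWaringType_singleton {d e : ℕ} :
    HasWaringType w {(d, e)} ↔ ∃ g, Irreducible g ∧ g.IsHomogeneous d ∧ 1 ≤ e ∧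
      catalecticantRank w = d * e ∧ g ^ e ∈ apolarIdeal w := by
  simp only [HasWaringType, hasSplittingType_singleton]
  constructor
  · rintro ⟨φ, h0, hm, g, h1, h2, h3, h4⟩
    refine ⟨g, h1, h2, h3, ?_, mem_ideal_of_associated h4 hm⟩
    have h0' : (φ : MvPolynomial (Fin 2) k) ≠ 0 := by simpa using h0
    exact le_antisymm (le_of_dvd φ.2 (h2.pow e) (pow_ne_zero _ h1.ne_zero) h4.dvd)
      (le_of_dvd (h2.pow e) φ.2 h0' h4.symm.dvd)
  · rintro ⟨g, h1, h2, h3, h4, h5⟩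
    exact ⟨⟨g ^ e, h4 ▸ h2.pow e⟩, fun h => pow_ne_zero e h1.ne_zero (congrArg Subtype.val h), h5,
      g, h1, h2, h3, Associated.refl _⟩

lemma hasWaringType_pair {d₁ e₁ d₂ e₂ : ℕ} :
    HasWaringType w {(d₁, e₁), (d₂, e₂)} ↔ ∃ g₁ g₂, (Irreducible g₁ ∧ g₁.IsHomogeneous d₁) ∧
      (Irreducible g₂ ∧ g₂.IsHomogeneous d₂) ∧ 1 ≤ e₁ ∧ 1 ≤ e₂ ∧ ¬ Associated g₁ g₂ ∧
      catalecticantRank w = d₁ * e₁ + d₂ * e₂ ∧ g₁ ^ e₁ * g₂ ^ e₂ ∈ apolarIdeal w := by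
  simp only [HasWaringType, hasSplittingType_pair]
  constructor
  · rintro ⟨φ, h0, hm, g₁, g₂, h1, h2, he1, he2, h3, h4⟩
    refine ⟨g₁, g₂, h1, h2, he1, he2, h3, ?_, mem_ideal_of_associated h4 hm⟩
    have h0' : (φ : MvPolynomial (Fin 2) k) ≠ 0 := by simpa using h0
    have hom := (h1.2.pow e₁).mul (h2.2.pow e₂)
    exact le_antisymm (le_of_dvd φ.2 hom
      (mul_ne_zero (pow_ne_zero _ h1.1.ne_zero) (pow_ne_zero _ h2.1.ne_zero)) h4.dvd)
      (le_of_dvd hom φ.2 h0' h4.symm.dvd)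
  · rintro ⟨g₁, g₂, h1, h2, he1, he2, h3, h4, h5⟩
    exact ⟨⟨_, h4 ▸ (h1.2.pow e₁).mul (h2.2.pow e₂)⟩, fun h => mul_ne_zero
      (pow_ne_zero _ h1.1.ne_zero) (pow_ne_zero _ h2.1.ne_zero) (congrArg Subtype.val h), h5,
      g₁, g₂, h1, h2, he1, he2, h3, Associated.refl _⟩

end

/-! ### Apolarity in coordinates -/

namespace Frame

variable (F : Frame k) (w : DualForm k 5)

/-- The coordinates of `w` in the basis dual to the monomials in the two forms of the frame. -/
def coords (i : ℕ) : k := extend w (F.l ^ (5 - i) * F.m ^ i)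

variable {w}

lemma eq_zero_iff : w = 0 ↔ ∀ i ≤ 5, F.coords w i = 0 := by
  constructor
  · rintro rfl i -
    rw [coords, extend, LinearMap.zero_comp, LinearMap.zero_apply]
  · intro h
    ext v
    rw [← extend_coe]
    obtain ⟨c, hc⟩ := F.exists_expansion v.2
    rw [hc, map_sum, LinearMap.zero_apply]
    refine Finset.sum_eq_zero fun i _ => ?_
    rw [extend_C_mul]
    exact mul_eq_zero_of_right _ (h i (Nat.lt_succ_iff.mp i.2))

lemma linear_mem_iff (c₀ c₁ : k) : (F.linear c₀ c₁ : MvPolynomial (Fin 2) k) ∈ apolarIdeal w ↔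
    ∀ i ≤ 4, c₀ * F.coords w i + c₁ * F.coords w (i + 1) = 0 := by
  rw [F.mem_apolarIdeal_iff (e := 4) rfl (F.linear c₀ c₁).2]
  refine forall₂_congr fun i hi => ?_
  rw [coords, coords, ← extend_C_mul, ← extend_C_mul, ← map_add, coe_linear]
  congr! 2
  have h1 : 5 - i = (4 - i) + 1 := by omega
  have h2 : 5 - (i + 1) = 4 - i := by omega
  rw [h1, h2]
  ring

lemma quad_mem_iff (c₀ c₁ c₂ : k) : (F.quad c₀ c₁ c₂ : MvPolynomial (Fin 2) k) ∈ apolarIdeal w ↔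
    ∀ i ≤ 3, c₀ * F.coords w i + c₁ * F.coords w (i + 1) + c₂ * F.coords w (i + 2) = 0 := by
  rw [F.mem_apolarIdeal_iff (e := 3) rfl (F.quad c₀ c₁ c₂).2]
  refine forall₂_congr fun i hi => ?_
  rw [coords, coords, coords, ← extend_C_mul, ← extend_C_mul, ← extend_C_mul, ← map_add, ← map_add,
    coe_quad]
  congr! 2
  have h1 : 5 - i = (3 - i) + 2 := by omega
  have h2 : 5 - (i + 1) = (3 - i) + 1 := by omega
  have h3 : 5 - (i + 2) = 3 - i := by omega
  rw [h1, h2, h3]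
  ring

lemma linear_sq (c₀ c₁ : k) : (F.linear c₀ c₁ : MvPolynomial (Fin 2) k) ^ 2 =
    F.quad (c₀ ^ 2) (2 * c₀ * c₁) (c₁ ^ 2) := by
  simp only [coe_linear, coe_quad, map_mul, map_pow, map_ofNat]
  ring

/-- The equations for $i=0,1$ are the two conics in $\mathbf P(V_2^*)$ whose intersection is the
range of summation in $C(w)$. -/
lemma quad_sq_mem_iff (c₀ c₁ c₂ : k) :
    (F.quad c₀ c₁ c₂ : MvPolynomial (Fin 2) k) ^ 2 ∈ apolarIdeal w ↔
    ∀ i ≤ 1, c₀ ^ 2 * F.coords w i + 2 * c₀ * c₁ * F.coords w (i + 1) +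
      (c₁ ^ 2 + 2 * c₀ * c₂) * F.coords w (i + 2) + 2 * c₁ * c₂ * F.coords w (i + 3) +
      c₂ ^ 2 * F.coords w (i + 4) = 0 := by
  rw [F.mem_apolarIdeal_iff (e := 1) rfl (IsHomogeneous.pow (F.quad c₀ c₁ c₂).2 2)]
  refine forall₂_congr fun i hi => ?_
  simp only [coords, ← extend_C_mul, ← map_add, coe_quad]
  congr! 2
  have h1 : 5 - i = (1 - i) + 4 := by omega
  have h2 : 5 - (i + 1) = (1 - i) + 3 := by omega
  have h3 : 5 - (i + 2) = (1 - i) + 2 := by omega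
  have h4 : 5 - (i + 3) = (1 - i) + 1 := by omega
  have h5 : 5 - (i + 4) = 1 - i := by omega
  simp only [h1, h2, h3, h4, h5, map_add, map_mul, map_pow, map_ofNat]
  ring

lemma cubic_mem_iff (c₀ c₁ c₂ c₃ : k) : C c₀ * F.l ^ 3 + C c₁ * (F.l ^ 2 * F.m) +
      C c₂ * (F.l * F.m ^ 2) + C c₃ * F.m ^ 3 ∈ apolarIdeal w ↔
    ∀ i ≤ 2, c₀ * F.coords w i + c₁ * F.coords w (i + 1) + c₂ * F.coords w (i + 2) +
      c₃ * F.coords w (i + 3) = 0 := by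
  have hom : (C c₀ * F.l ^ 3 + C c₁ * (F.l ^ 2 * F.m) +
      C c₂ * (F.l * F.m ^ 2) + C c₃ * F.m ^ 3).IsHomogeneous 3 := by
    have h := F.isHomogeneous_mul_pow
    have h0 := (h 3 0).C_mul c₀
    have h1 := (h 2 1).C_mul c₁
    have h2 := (h 1 2).C_mul c₂
    have h3 := (h 0 3).C_mul c₃
    simp only [pow_zero, pow_one, mul_one, one_mul] at h0 h1 h2 h3
    exact ((h0.add h1).add h2).add h3
  rw [F.mem_apolarIdeal_iff (e := 2) rfl hom]
  refine forall₂_congr fun i hi => ?_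
  simp only [coords, ← extend_C_mul, ← map_add]
  congr! 2
  have h1 : 5 - i = (2 - i) + 3 := by omega
  have h2 : 5 - (i + 1) = (2 - i) + 2 := by omega
  have h3 : 5 - (i + 2) = (2 - i) + 1 := by omega
  have h4 : 5 - (i + 3) = 2 - i := by omega
  simp only [h1, h2, h3, h4]
  ring

end Frame

/-! ### The catalecticant rank from the apolar quadratic forms -/

section
variable {w : DualForm k 5}

lemma catalecticantRank_eq_two {φ : Form k 2} (hφ : φ ≠ 0)
    (h : ∀ ψ : Form k 2, (ψ : MvPolynomial (Fin 2) k) ∈ apolarIdeal w ↔ ∃ t : k, t • φ = ψ) :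
    catalecticantRank w = 2 := by
  have h1 : apolarForms w 2 = k ∙ φ := by
    ext ψ
    rw [mem_apolarForms, h, Submodule.mem_span_singleton]
  have h2 := catalecticantRank_add_quadrics w
  rw [h1, finrank_span_singleton hφ] at h2
  omega

lemma catalecticantRank_zero : catalecticantRank (0 : DualForm k 5) = 0 := by
  have h1 : apolarForms (0 : DualForm k 5) 2 = ⊤ := by
    rw [eq_top_iff]
    intro ψ _
    rw [mem_apolarForms, mem_apolarIdeal]
    intro u
    rw [extend, LinearMap.zero_comp, LinearMap.zero_apply]
  have h2 := catalecticantRank_add_quadrics (0 : DualForm k 5)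
  rw [h1, finrank_top, finrank_form] at h2
  omega

lemma eq_zero_of_quadratic_mem (h : catalecticantRank w = 3) {ψ : Form k 2}
    (hψ : (ψ : MvPolynomial (Fin 2) k) ∈ apolarIdeal w) : ψ = 0 := by
  have h2 := catalecticantRank_add_quadrics w
  have h1 : Module.finrank k (apolarForms w 2) = 0 := by omega
  rw [Submodule.finrank_eq_zero] at h1
  have : ψ ∈ apolarForms w 2 := hψ
  rwa [h1, Submodule.mem_bot] at this

lemma finrank_apolarForms_eq_two {L : Form k 2 →ₗ[k] k} (hL : L ≠ 0)
    (h : ∀ ψ : Form k 2, (ψ : MvPolynomial (Fin 2) k) ∈ apolarIdeal w ↔ L ψ = 0) :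
    Module.finrank k (apolarForms w 2) = 2 := by
  have h1 : apolarForms w 2 = LinearMap.ker L := by
    ext ψ
    rw [mem_apolarForms, h, LinearMap.mem_ker]
  have h3 := Module.Dual.finrank_ker_add_one_of_ne_zero (f := L) hL
  rw [finrank_form] at h3
  rw [h1]
  exact Nat.succ_injective h3

lemma Frame.exists_functional (F : Frame k) (h : ∀ i ≤ 4, F.coords w i = 0) :
    ∃ L : Form k 2 →ₗ[k] k, ∀ c₀ c₁ c₂, L (F.quad c₀ c₁ c₂) = c₂ * F.coords w 5 := by
  obtain ⟨L, hL⟩ := exists_functional_extend_mul w (F.m ^ 3) 2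
  refine ⟨L, fun c₀ c₁ c₂ => ?_⟩
  have : F.m ^ 3 * (F.quad c₀ c₁ c₂ : MvPolynomial (Fin 2) k) =
      C c₀ * (F.l ^ (5 - 3) * F.m ^ 3) + C c₁ * (F.l ^ (5 - 4) * F.m ^ 4) +
        C c₂ * (F.l ^ (5 - 5) * F.m ^ 5) := by
    rw [Frame.coe_quad]
    ring
  rw [hL, this, map_add, map_add, extend_C_mul, extend_C_mul, extend_C_mul, ← coords, ← coords,
    ← coords, h 3 (by norm_num), h 4 (by norm_num)]
  ring

lemma Frame.coords_five_ne_zero (F : Frame k) (hw : w ≠ 0) (h : ∀ i ≤ 4, F.coords w i = 0) :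
    F.coords w 5 ≠ 0 := fun h5 => hw (F.eq_zero_iff.mpr fun i hi => by
  rcases Nat.lt_or_ge i 5 with h' | h'
  · exact h i (by omega)
  · obtain rfl : i = 5 := by omega
    exact h5)

/-- With $l=f$ as first form of a frame, only the coordinate of $w$ at $m^5$ survives. The apolar
quadratic forms are those without $m^2$ term, a space of dimension 2. -/
lemma catalecticantRank_eq_one {f : MvPolynomial (Fin 2) k} (hf : f.IsHomogeneous 1) (hf0 : f ≠ 0)
    (hw : w ≠ 0) (h : f ∈ apolarIdeal w) : catalecticantRank w = 1 := by
  obtain ⟨F, rfl⟩ := Frame.exists_of_ne_zero hf hf0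
  have hl : ((F.linear 1 0 : Form k 1) : MvPolynomial (Fin 2) k) ∈ apolarIdeal w := by
    simpa [Frame.coe_linear] using h
  rw [F.linear_mem_iff] at hl
  have ha : ∀ i ≤ 4, F.coords w i = 0 := fun i hi => by simpa using hl i hi
  have h5 := F.coords_five_ne_zero hw ha
  obtain ⟨L, hL⟩ := F.exists_functional ha
  have hL0 : L ≠ 0 := by
    rintro rfl
    exact h5 (by simpa using (hL 0 0 1).symm)
  have h2 := catalecticantRank_add_quadrics w
  rw [finrank_apolarForms_eq_two hL0] at h2
  · omega
  · intro ψ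
    obtain ⟨c₀, c₁, c₂, rfl⟩ := F.exists_eq_quad ψ
    rw [F.quad_mem_iff, hL]
    constructor
    · intro h
      simpa [ha 3, ha 4] using h 3 le_rfl
    · intro h i hi
      have hc : c₂ = 0 := (mul_eq_zero.mp h).resolve_right h5
      rw [ha i (by omega), ha (i + 1) (by omega), hc]
      ring

end

end

section

/-! ### Explicit apolarity conditions -/

lemma forall_le_one {P : ℕ → Prop} : (∀ i ≤ 1, P i) ↔ P 0 ∧ P 1 :=
  ⟨fun h => ⟨h 0 (by norm_num), h 1 (by norm_num)⟩, by
    rintro ⟨h0, h1⟩ i hi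
    interval_cases i <;> assumption⟩

lemma forall_le_two {P : ℕ → Prop} : (∀ i ≤ 2, P i) ↔ P 0 ∧ P 1 ∧ P 2 :=
  ⟨fun h => ⟨h 0 (by norm_num), h 1 (by norm_num), h 2 (by norm_num)⟩, by
    rintro ⟨h0, h1, h2⟩ i hi
    interval_cases i <;> assumption⟩

lemma forall_le_three {P : ℕ → Prop} : (∀ i ≤ 3, P i) ↔ P 0 ∧ P 1 ∧ P 2 ∧ P 3 :=
  ⟨fun h => ⟨h 0 (by norm_num), h 1 (by norm_num), h 2 (by norm_num), h 3 (by norm_num)⟩, by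
    rintro ⟨h0, h1, h2, h3⟩ i hi
    interval_cases i <;> assumption⟩

lemma forall_le_five {P : ℕ → Prop} :
    (∀ i ≤ 5, P i) ↔ P 0 ∧ P 1 ∧ P 2 ∧ P 3 ∧ P 4 ∧ P 5 :=
  ⟨fun h => ⟨h 0 (by norm_num), h 1 (by norm_num), h 2 (by norm_num), h 3 (by norm_num),
    h 4 (by norm_num), h 5 (by norm_num)⟩, by
    rintro ⟨h0, h1, h2, h3, h4, h5⟩ i hi
    interval_cases i <;> assumption⟩

namespace Frame

section
variable {k : Type*} [Field k] (F : Frame k) {w : DualForm k 5}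

lemma eq_zero_iff' : w = 0 ↔ F.coords w 0 = 0 ∧ F.coords w 1 = 0 ∧ F.coords w 2 = 0 ∧
    F.coords w 3 = 0 ∧ F.coords w 4 = 0 ∧ F.coords w 5 = 0 := by
  rw [F.eq_zero_iff, forall_le_five]

lemma quad_mem_iff' (c₀ c₁ c₂ : k) : (F.quad c₀ c₁ c₂ : MvPolynomial (Fin 2) k) ∈ apolarIdeal w ↔
    c₀ * F.coords w 0 + c₁ * F.coords w 1 + c₂ * F.coords w 2 = 0 ∧
    c₀ * F.coords w 1 + c₁ * F.coords w 2 + c₂ * F.coords w 3 = 0 ∧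
    c₀ * F.coords w 2 + c₁ * F.coords w 3 + c₂ * F.coords w 4 = 0 ∧
    c₀ * F.coords w 3 + c₁ * F.coords w 4 + c₂ * F.coords w 5 = 0 := by
  rw [F.quad_mem_iff, forall_le_three]

lemma quad_sq_mem_iff' (c₀ c₁ c₂ : k) :
    (F.quad c₀ c₁ c₂ : MvPolynomial (Fin 2) k) ^ 2 ∈ apolarIdeal w ↔
    c₀ ^ 2 * F.coords w 0 + 2 * c₀ * c₁ * F.coords w 1 +
      (c₁ ^ 2 + 2 * c₀ * c₂) * F.coords w 2 + 2 * c₁ * c₂ * F.coords w 3 +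
      c₂ ^ 2 * F.coords w 4 = 0 ∧
    c₀ ^ 2 * F.coords w 1 + 2 * c₀ * c₁ * F.coords w 2 +
      (c₁ ^ 2 + 2 * c₀ * c₂) * F.coords w 3 + 2 * c₁ * c₂ * F.coords w 4 +
      c₂ ^ 2 * F.coords w 5 = 0 := by
  rw [F.quad_sq_mem_iff, forall_le_one]

lemma l_sq_mem_iff : F.l ^ 2 ∈ apolarIdeal w ↔
    F.coords w 0 = 0 ∧ F.coords w 1 = 0 ∧ F.coords w 2 = 0 ∧ F.coords w 3 = 0 := by
  have h := F.quad_mem_iff' (w := w) 1 0 0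
  simpa [coe_quad] using h

lemma l_mul_m_mem_iff : F.l * F.m ∈ apolarIdeal w ↔
    F.coords w 1 = 0 ∧ F.coords w 2 = 0 ∧ F.coords w 3 = 0 ∧ F.coords w 4 = 0 := by
  have h := F.quad_mem_iff' (w := w) 0 1 0
  simpa [coe_quad] using h

lemma m_sq_sub_mem_iff (d : k) : F.m ^ 2 - C d * F.l ^ 2 ∈ apolarIdeal w ↔
    F.coords w 2 = d * F.coords w 0 ∧ F.coords w 3 = d * F.coords w 1 ∧
    F.coords w 4 = d * F.coords w 2 ∧ F.coords w 5 = d * F.coords w 3 := by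
  have h := F.quad_mem_iff' (w := w) (-d) 0 1
  rw [show (F.quad (-d) 0 1 : MvPolynomial (Fin 2) k) = F.m ^ 2 - C d * F.l ^ 2 by
    simp only [coe_quad, map_neg, map_zero, map_one]; ring] at h
  rw [h]
  constructor <;> rintro ⟨h0, h1, h2, h3⟩ <;> refine ⟨?_, ?_, ?_, ?_⟩
  · linear_combination h0
  · linear_combination h1
  · linear_combination h2
  · linear_combination h3
  · linear_combination h0
  · linear_combination h1
  · linear_combination h2
  · linear_combination h3

lemma l_cube_mem_iff : F.l ^ 3 ∈ apolarIdeal w ↔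
    F.coords w 0 = 0 ∧ F.coords w 1 = 0 ∧ F.coords w 2 = 0 := by
  have h := F.cubic_mem_iff (w := w) 1 0 0 0
  simp only [map_one, map_zero, zero_mul, one_mul, add_zero] at h
  rw [h, forall_le_two]

lemma l_sq_mul_m_mem_iff : F.l ^ 2 * F.m ∈ apolarIdeal w ↔
    F.coords w 1 = 0 ∧ F.coords w 2 = 0 ∧ F.coords w 3 = 0 := by
  have h := F.cubic_mem_iff (w := w) 0 1 0 0
  simp only [map_one, map_zero, zero_mul, one_mul, add_zero, zero_add] at h
  rw [h, forall_le_two]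

/-! ### The catalecticant rank in the special cases -/

lemma catalecticantRank_of_l_sq (h : F.l ^ 2 ∈ apolarIdeal w) (h4 : F.coords w 4 ≠ 0) :
    catalecticantRank w = 2 := by
  have h0 := F.l_sq_mem_iff.mp h
  refine catalecticantRank_eq_two (φ := F.quad 1 0 0) (fun e => by simpa using F.quad_eq_zero.mp e)
    fun ψ => ?_
  obtain ⟨c₀, c₁, c₂, rfl⟩ := F.exists_eq_quad ψ
  simp only [F.quad_mem_iff', smul_quad, quad_inj, h0]
  constructor
  · rintro ⟨-, -, h2, h3⟩
    have e2 : c₂ = 0 := by simpa [h4] using h2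
    subst e2
    exact ⟨c₀, by ring, by simpa [h4, eq_comm] using h3, by ring⟩
  · rintro ⟨t, -, rfl, rfl⟩
    simp

lemma catalecticantRank_of_l_mul_m (h : F.l * F.m ∈ apolarIdeal w) (h0 : F.coords w 0 ≠ 0)
    (h5 : F.coords w 5 ≠ 0) : catalecticantRank w = 2 := by
  have h := F.l_mul_m_mem_iff.mp h
  refine catalecticantRank_eq_two (φ := F.quad 0 1 0) (fun e => by simpa using F.quad_eq_zero.mp e)
    fun ψ => ?_
  obtain ⟨c₀, c₁, c₂, rfl⟩ := F.exists_eq_quad ψ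
  simp only [F.quad_mem_iff', smul_quad, quad_inj, h]
  constructor
  · rintro ⟨h1, -, -, h3⟩
    exact ⟨c₁, by simpa [h0, eq_comm] using h1, by ring, by simpa [h5, eq_comm] using h3⟩
  · rintro ⟨t, rfl, -, rfl⟩
    simp

/-- The hypotheses say that $(A+B\sqrt d)(b+a\sqrt d)=0$ in the field $k(\sqrt d)$; the proof uses
the norm $A^2-dB^2$, which is nonzero if $B\ne0$. -/
lemma eq_zero_of_not_isSquare {d A B a b : k} (hd : ¬ IsSquare d) (hab : ¬ (a = 0 ∧ b = 0))
    (h0 : A * a + B * b = 0) (h1 : A * b + B * (d * a) = 0) : A = 0 ∧ B = 0 := by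
  rcases eq_or_ne B 0 with rfl | hb
  · refine ⟨?_, rfl⟩
    by_contra hA
    simp [hA] at h0 h1
    exact hab ⟨h0, h1⟩
  · exfalso
    have h2 : a * (A ^ 2 - d * B ^ 2) = 0 := by linear_combination A * h0 - B * h1
    have h3 : A ^ 2 - d * B ^ 2 ≠ 0 := fun e => hd ⟨A / B, by field_simp; linear_combination -e⟩
    have ha : a = 0 := (mul_eq_zero.mp h2).resolve_right h3
    subst ha
    exact hab ⟨rfl, by simpa [hb] using h0⟩

lemma coords_ne_zero_of_m_sq_sub {d : k} (h : F.m ^ 2 - C d * F.l ^ 2 ∈ apolarIdeal w)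
    (hw : w ≠ 0) : ¬ (F.coords w 0 = 0 ∧ F.coords w 1 = 0) := by
  rintro ⟨h0, h1⟩
  obtain ⟨h2, h3, h4, h5⟩ := (F.m_sq_sub_mem_iff d).mp h
  rw [h0, mul_zero] at h2
  rw [h1, mul_zero] at h3
  rw [h2, mul_zero] at h4
  rw [h3, mul_zero] at h5
  exact hw (F.eq_zero_iff'.mpr ⟨h0, h1, h2, h3, h4, h5⟩)

lemma catalecticantRank_of_m_sq_sub {d : k} (h : F.m ^ 2 - C d * F.l ^ 2 ∈ apolarIdeal w)
    (hd : ¬ IsSquare d) (hw : w ≠ 0) : catalecticantRank w = 2 := by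
  have hab := F.coords_ne_zero_of_m_sq_sub h hw
  obtain ⟨h2, h3, h4, h5⟩ := (F.m_sq_sub_mem_iff d).mp h
  refine catalecticantRank_eq_two (φ := F.quad (-d) 0 1)
    (fun e => by simpa using F.quad_eq_zero.mp e) fun ψ => ?_
  obtain ⟨c₀, c₁, c₂, rfl⟩ := F.exists_eq_quad ψ
  simp only [F.quad_mem_iff', smul_quad, quad_inj, h5, h4, h3, h2]
  constructor
  · rintro ⟨e0, e1, -, -⟩
    have := eq_zero_of_not_isSquare (A := c₀ + d * c₂) (B := c₁) hd hab
      (by linear_combination e0) (by linear_combination e1)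
    exact ⟨c₂, by linear_combination -this.1, by rw [this.2, mul_zero], by ring⟩
  · rintro ⟨t, rfl, rfl, rfl⟩
    refine ⟨?_, ?_, ?_, ?_⟩ <;> ring

end

/-! ### The two counts in coordinates -/

section
variable {p : ℕ} [Fact p.Prime] (F : Frame (ZMod p)) {w : DualForm (ZMod p) 5}

open scoped Classical in
lemma numSquares_eq : numSquares w =
    (if F.l ^ 2 ∈ apolarIdeal w then 1 else 0) + ∑ t,
      if (F.quad (t ^ 2) (2 * t) 1 : MvPolynomial (Fin 2) (ZMod p)) ∈ apolarIdeal w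
        then 1 else 0 := by
  rw [numSquares, F.sum_linear
    (fun f => if (f : MvPolynomial (Fin 2) (ZMod p)) ^ 2 ∈ apolarIdeal w then 1 else 0)]
  · simp [linear_sq, coe_quad]
  · intro t f ht
    simp only [Submodule.coe_smul, smul_eq_C_mul, mul_pow]
    exact if_congr (Ideal.unit_mul_mem_iff_mem _ (((IsUnit.mk0 t ht).map C).pow 2)) rfl rfl

open scoped Classical in
-- The point $l^2$ drops out, having discriminant 0, and the points $tl^2+lm$ have nonzero square
-- discriminant, so each counts 1.
lemma legendreSum_eq : legendreSum w = -(
    ∑ t, (if (F.quad t 1 0 : MvPolynomial (Fin 2) (ZMod p)) ^ 2 ∈ apolarIdeal w then 1 else 0) +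
    ∑ st : ZMod p × ZMod p with
      (F.quad st.2 st.1 1 : MvPolynomial (Fin 2) (ZMod p)) ^ 2 ∈ apolarIdeal w,
      quadraticChar (ZMod p) (st.1 ^ 2 - 4 * st.2)) := by
  rw [BinaryForms.legendreSum_eq, F.sum_quad
    (fun f => if (f : MvPolynomial (Fin 2) (ZMod p)) ^ 2 ∈ apolarIdeal w then
      quadraticChar (ZMod p) (quadDisc f) else 0)]
  · rw [Finset.sum_filter, Fintype.sum_prod_type]
    have hD : ∀ x, quadraticChar (ZMod p) (F.det ^ 2 * x) = quadraticChar (ZMod p) x := fun x => by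
      rw [map_mul, quadraticChar_sq_one' (show F.det ≠ 0 from F.det_ne_zero), one_mul]
    simp only [quadDisc_quad, hD]
    simp [-quadraticChar_apply, MulChar.map_zero]
  · intro t f ht
    simp only [Submodule.coe_smul, smul_eq_C_mul, mul_pow]
    refine if_congr (Ideal.unit_mul_mem_iff_mem _ (((IsUnit.mk0 t ht).map C).pow 2)) ?_ rfl
    exact quadraticChar_quadDisc_smul ht f

lemma ringChar_ne_two (hp : 2 < p) : ringChar (ZMod p) ≠ 2 := by
  rw [ZMod.ringChar_zmod_n]
  omega

lemma two_ne_zero_zmod (hp : 2 < p) : (2 : ZMod p) ≠ 0 := Ring.two_ne_zero (ringChar_ne_two hp)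

lemma counts_zero (hp : 2 < p) : numSquares (0 : DualForm (ZMod p) 5) = p + 1 ∧
    legendreSum (0 : DualForm (ZMod p) 5) = -p := by
  have h : ∀ v, v ∈ apolarIdeal (0 : DualForm (ZMod p) 5) := fun v => by
    rw [mem_apolarIdeal]
    intro u
    rw [extend, LinearMap.zero_comp, LinearMap.zero_apply]
  rw [(std (ZMod p)).numSquares_eq, (std (ZMod p)).legendreSum_eq]
  simp only [h, if_true]
  constructor
  · simp [add_comm]
  · rw [Finset.filter_true, Fintype.sum_prod_type]
    simp [-quadraticChar_apply, sum_quadraticChar_sub_four_mul (ringChar_ne_two hp)]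

/-- Here $f^2$ is apolar exactly when $l\mid f$: the equations force the coefficient of $m^2$ to
vanish. The $p$ points $tl^2+lm$ contribute 1 each and $l^2$ contributes 0. -/
lemma counts_of_l_sq (hw : w ≠ 0) (h : F.l ^ 2 ∈ apolarIdeal w) :
    numSquares w = 1 ∧ legendreSum w = -p := by
  have h0 := F.l_sq_mem_iff.mp h
  have h1 : ¬ (F.coords w 4 = 0 ∧ F.coords w 5 = 0) := fun e =>
    hw (F.eq_zero_iff'.mpr ⟨h0.1, h0.2.1, h0.2.2.1, h0.2.2.2, e⟩)
  rw [F.numSquares_eq, F.legendreSum_eq]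
  simp only [quad_mem_iff', quad_sq_mem_iff', h, h0]
  constructor
  · rw [if_pos (by simp), Finset.sum_eq_zero, add_zero]
    intro t _
    rw [if_neg]
    rintro ⟨-, -, e2, e3⟩
    have e4 : F.coords w 4 = 0 := by simpa using e2
    exact h1 ⟨e4, by simpa [e4] using e3⟩
  · rw [Finset.filter_false_of_mem]
    · simp
    · rintro ⟨s, t⟩ - ⟨e2, e3⟩
      have e4 : F.coords w 4 = 0 := by simpa using e2
      exact h1 ⟨e4, by simpa [e4] using e3⟩

/-- Only the coordinates 0 and 5 of $w$ survive, so the squares of the outer coefficients of $f$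
vanish and $f$ is proportional to $lm$. -/
lemma legendreSum_of_l_mul_m (h : F.l * F.m ∈ apolarIdeal w) (h0 : F.coords w 0 ≠ 0)
    (h5 : F.coords w 5 ≠ 0) : legendreSum w = -1 := by
  have h1 := F.l_mul_m_mem_iff.mp h
  rw [F.legendreSum_eq]
  simp only [quad_sq_mem_iff', h1]
  rw [Finset.filter_false_of_mem, Finset.sum_eq_single 0]
  · simp
  · intro t _ ht
    rw [if_neg]
    rintro ⟨e, -⟩
    simp [ht, h0] at e
  · simp
  · rintro ⟨s, t⟩ - ⟨-, e⟩
    simp [h5] at e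

/-- Modulo $m^2=dl^2$ the form $f$ becomes $(c_0+dc_2)l^2+c_1lm$, and its square becomes
$Al^4+Bl^3m$. Apolarity forces $A=B=0$, so $f$ is proportional to $m^2-dl^2$, whose discriminant is
a square times the non-square $d$. -/
lemma legendreSum_of_m_sq_sub (hp : 2 < p) {d : ZMod p}
    (h : F.m ^ 2 - C d * F.l ^ 2 ∈ apolarIdeal w) (hd : ¬ IsSquare d) (hw : w ≠ 0) :
    legendreSum w = 1 := by
  have hab := F.coords_ne_zero_of_m_sq_sub h hw
  obtain ⟨h2, h3, h4, h5⟩ := (F.m_sq_sub_mem_iff d).mp h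
  have h20 := two_ne_zero_zmod hp
  have hd0 : d ≠ 0 := fun e => hd (e ▸ IsSquare.zero)
  have key : ∀ c₀ c₁ c₂ : ZMod p,
      (F.quad c₀ c₁ c₂ : MvPolynomial (Fin 2) (ZMod p)) ^ 2 ∈ apolarIdeal w ↔
      c₀ + d * c₂ = 0 ∧ c₁ = 0 := by
    intro c₀ c₁ c₂
    simp only [F.quad_sq_mem_iff', h5, h4, h3, h2]
    constructor
    · rintro ⟨e0, e1⟩
      obtain ⟨e2, e3⟩ := eq_zero_of_not_isSquare (A := (c₀ + d * c₂) ^ 2 + d * c₁ ^ 2)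
        (B := 2 * (c₀ + d * c₂) * c₁) hd hab
        (by linear_combination e0) (by linear_combination e1)
      rcases mul_eq_zero.mp e3 with e4 | e4
      · have e4 : c₀ + d * c₂ = 0 := by simpa [h20] using e4
        exact ⟨e4, by simpa [e4, hd0] using e2⟩
      · exact ⟨by simpa [e4] using e2, e4⟩
    · rintro ⟨e, rfl⟩
      constructor
      · linear_combination (c₀ + d * c₂) * F.coords w 0 * e
      · linear_combination (c₀ + d * c₂) * F.coords w 1 * e
  rw [F.legendreSum_eq]
  simp only [key]
  have hf : (Finset.univ.filter fun st : ZMod p × ZMod p => st.2 + d * 1 = 0 ∧ st.1 = 0) =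
      {(0, -d)} := by
    ext ⟨s, t⟩
    simp only [Finset.mem_filter, Finset.mem_univ, true_and, Finset.mem_singleton, Prod.mk.injEq,
      mul_one, add_eq_zero_iff_eq_neg]
    exact and_comm
  rw [hf, Finset.sum_singleton]
  have h4d : quadraticChar (ZMod p) (2 ^ 2 * d) = -1 := by
    rw [map_mul, quadraticChar_sq_one' h20, one_mul]
    exact (quadraticChar_neg_one_iff_not_isSquare).mpr hd
  rw [show ((0 : ZMod p), -d).1 ^ 2 - 4 * ((0 : ZMod p), -d).2 = 2 ^ 2 * d by ring, h4d]
  simp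

lemma abs_sum_quadraticChar_le {α : Type*} (S : Finset α) (f : α → ZMod p) {n : ℕ}
    (hS : S.card ≤ n) : |∑ x ∈ S, quadraticChar (ZMod p) (f x)| ≤ n := by
  refine le_trans ?_ (Nat.cast_le.mpr hS)
  refine (Finset.abs_sum_le_sum_abs _ _).trans ?_
  rw [Finset.card_eq_sum_ones]
  push_cast
  refine Finset.sum_le_sum fun x _ => ?_
  by_cases h : f x = 0
  · simp [h]
  · rcases quadraticChar_dichotomy h with e | e <;> rw [e] <;> simp

/-- No $tl^2+lm$ qualifies. If the coefficient of $m^2$ is 1, the first equation determines that of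
$lm$ and then the second determines that of $l^2$, so at most one point counts. -/
lemma legendreSum_of_l_cube (hp : 2 < p) (h : F.l ^ 3 ∈ apolarIdeal w)
    (h3 : F.coords w 3 ≠ 0) : |legendreSum w| ≤ 1 := by
  classical
  obtain ⟨h0, h1, h2⟩ := F.l_cube_mem_iff.mp h
  have h20 := two_ne_zero_zmod hp
  rw [F.legendreSum_eq, abs_neg]
  simp only [quad_sq_mem_iff', h0, h1, h2]
  rw [Finset.sum_eq_zero, zero_add]
  · refine (abs_sum_quadraticChar_le _ _ (n := 1) ?_).trans_eq Nat.cast_one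
    refine Finset.card_le_one.mpr ?_
    rintro ⟨s, t⟩ hst ⟨s', t'⟩ hst'
    simp only [Finset.mem_filter, Finset.mem_univ, true_and] at hst hst'
    obtain ⟨e0, e1⟩ := hst
    obtain ⟨e0', e1'⟩ := hst'
    have hs : s = s' := by
      refine mul_left_cancel₀ (mul_ne_zero h20 h3) ?_
      linear_combination e0 - e0'
    subst hs
    have ht : t = t' := by
      refine mul_left_cancel₀ (mul_ne_zero h20 h3) ?_
      linear_combination e1 - e1'
    rw [ht]
  · intro t _
    rw [if_neg]
    rintro ⟨-, e⟩
    simp [h3] at e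

/-- Among the $tl^2+lm$ only $lm$ qualifies, which accounts for the shift by 1. If the coefficient
of $m^2$ is 1, that of $lm$ is determined and that of $l^2$ has a prescribed square, so at most two
further points count. -/
lemma legendreSum_of_l_sq_mul_m (hp : 2 < p) (h : F.l ^ 2 * F.m ∈ apolarIdeal w)
    (h0 : F.coords w 0 ≠ 0) (h4 : F.coords w 4 ≠ 0) : |legendreSum w + 1| ≤ 2 := by
  classical
  obtain ⟨h1, h2, h3⟩ := F.l_sq_mul_m_mem_iff.mp h
  have h20 := two_ne_zero_zmod hp
  rw [F.legendreSum_eq]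
  simp only [quad_sq_mem_iff', h1, h2, h3]
  rw [Finset.sum_eq_single 0]
  · rw [if_pos (by simp), neg_add, neg_add_cancel_comm, abs_neg]
    refine (abs_sum_quadraticChar_le _ _ (n := 2) ?_).trans_eq Nat.cast_ofNat
    by_contra hc
    obtain ⟨⟨s, t⟩, ⟨s', t'⟩, ⟨s'', t''⟩, m1, m2, m3, n1, n2, n3⟩ :=
      Finset.two_lt_card_iff.mp (not_le.mp hc)
    simp only [Finset.mem_filter, Finset.mem_univ, true_and] at m1 m2 m3
    -- Distinct solutions agree in the coefficient of $lm$ and have opposite coefficients of $l^2$;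
    -- three pairwise distinct ones cannot exist.
    have hs : ∀ {a b c d : ZMod p}, 2 * a * 1 * F.coords w 4 = 2 * c * 1 * F.coords w 4 →
        b ^ 2 * F.coords w 0 = d ^ 2 * F.coords w 0 → (a, b) ≠ (c, d) → a = c ∧ b + d = 0 := by
      intro a b c d e e' n
      have hac : a = c := by
        refine mul_left_cancel₀ (mul_ne_zero h20 h4) ?_
        linear_combination e
      subst hac
      refine ⟨rfl, ?_⟩
      have hbd : b - d ≠ 0 := fun e => n (by rw [sub_eq_zero.mp e])
      have : (b - d) * (b + d) = 0 := by
        refine (mul_eq_zero.mp (?_ : F.coords w 0 * _ = 0)).resolve_left h0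
        linear_combination e'
      exact (mul_eq_zero.mp this).resolve_left hbd
    have k1 := hs (by linear_combination m1.2 - m2.2) (by linear_combination m1.1 - m2.1) n1
    have k2 := hs (by linear_combination m1.2 - m3.2) (by linear_combination m1.1 - m3.1) n2
    refine n3 ?_
    rw [← k1.1, ← k2.1, show t' = t'' by linear_combination k1.2 - k2.2]
  · intro t _ ht
    rw [if_neg]
    rintro ⟨e, -⟩
    simp [ht, h0] at e
  · simp

end

end Frame

end

section

/-! ### Pencils of conics -/

section
variable {k : Type*} [Field k]

lemma exists_eq_combination {a b c : Form k 2} (h : LinearIndependent k ![a, b, c])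
    (f : Form k 2) : ∃ α β γ : k, f = α • a + β • b + γ • c := by
  let B := basisOfLinearIndependentOfCardEqFinrank h (by rw [finrank_form, Fintype.card_fin])
  refine ⟨B.repr f 0, B.repr f 1, B.repr f 2, ?_⟩
  have := B.sum_repr f
  rw [Fin.sum_univ_three] at this
  simpa [B] using this.symm

lemma linearIndependent_triple_iff {V : Type*} [AddCommGroup V] [Module k V] {a b c : V}
    (h : LinearIndependent k ![b, c]) :
    LinearIndependent k ![a, b, c] ↔ a ∉ Submodule.span k {b, c} := by
  have := linearIndependent_finCons (K := k) (x := a) (v := ![b, c])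
  simp only [h, true_and] at this
  rw [show Set.range ![b, c] = {b, c} by simp [Set.pair_comm]] at this
  exact this

variable {w : DualForm k 5}

/-- The bilinear form `(f, g) ↦ (w, f g u)` on quadratic forms. -/
def pairing (w : DualForm k 5) (u : MvPolynomial (Fin 2) k) (f g : Form k 2) : k :=
  extend w (u * (f * g))

lemma pairing_comm (u : MvPolynomial (Fin 2) k) (f g : Form k 2) :
    pairing w u f g = pairing w u g f := by
  rw [pairing, pairing, mul_comm (f : MvPolynomial (Fin 2) k)]

lemma pairing_add_left (u : MvPolynomial (Fin 2) k) (f f' g : Form k 2) :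
    pairing w u (f + f') g = pairing w u f g + pairing w u f' g := by
  rw [pairing, pairing, pairing, ← map_add, Submodule.coe_add]
  congr 1
  ring

lemma pairing_smul_left (u : MvPolynomial (Fin 2) k) (t : k) (f g : Form k 2) :
    pairing w u (t • f) g = t * pairing w u f g := by
  rw [pairing, pairing, ← extend_C_mul, Submodule.coe_smul, smul_eq_C_mul]
  congr 1
  ring

lemma pairing_add_right (u : MvPolynomial (Fin 2) k) (f g g' : Form k 2) :
    pairing w u f (g + g') = pairing w u f g + pairing w u f g' := by
  rw [pairing_comm, pairing_add_left, pairing_comm u g, pairing_comm u g']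

lemma pairing_smul_right (u : MvPolynomial (Fin 2) k) (t : k) (f g : Form k 2) :
    pairing w u f (t • g) = t * pairing w u f g := by
  rw [pairing_comm, pairing_smul_left, pairing_comm]

lemma pairing_eq_zero_of_mem {f g : Form k 2}
    (h : (f * g : MvPolynomial (Fin 2) k) ∈ apolarIdeal w) (u : MvPolynomial (Fin 2) k) :
    pairing w u f g = 0 := by
  rw [pairing, mul_comm]
  exact mem_apolarIdeal.mp h u

lemma mul_mem_of_pairing {u : MvPolynomial (Fin 2) k} (hu : u.IsHomogeneous 1) {f : Form k 2}
    (h : ∀ g, pairing w u f g = 0) : (f * u : MvPolynomial (Fin 2) k) ∈ apolarIdeal w := by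
  refine mem_apolarIdeal_of_forall_form (d := 3) (e := 2) rfl (IsHomogeneous.mul f.2 hu)
    fun g hg => ?_
  have := h ⟨g, hg⟩
  rwa [pairing, ← mul_assoc, mul_comm u] at this

/-- Every quartic monomial is a product of two quadratic ones, so the pairing sees all of
$(w,u\,\cdot)$ in degree 4. -/
lemma mem_apolarIdeal_of_pairing {u : MvPolynomial (Fin 2) k} (hu : u.IsHomogeneous 1)
    (h : ∀ f g, pairing w u f g = 0) : u ∈ apolarIdeal w := by
  refine mem_apolarIdeal_of_forall_form (d := 1) (e := 4) rfl hu fun v hv => ?_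
  obtain ⟨c, rfl⟩ := (Frame.std k).exists_expansion hv
  rw [Finset.mul_sum, map_sum]
  refine Finset.sum_eq_zero fun i _ => ?_
  rw [mul_left_comm, extend_C_mul]
  refine mul_eq_zero_of_right _ ?_
  generalize Frame.std k = F
  have hq : ∀ i j i' j', i + j = 2 → i' + j' = 2 →
      extend w (u * (F.l ^ (i + i') * F.m ^ (j + j'))) = 0 := by
    intro i j i' j' h1 h2
    have := h ⟨_, h1 ▸ F.isHomogeneous_mul_pow i j⟩ ⟨_, h2 ▸ F.isHomogeneous_mul_pow i' j'⟩
    rw [pairing] at this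
    rw [← this]
    congr 2
    ring
  fin_cases i
  · exact hq 2 0 2 0 rfl rfl
  · exact hq 2 0 1 1 rfl rfl
  · exact hq 2 0 0 2 rfl rfl
  · exact hq 1 1 0 2 rfl rfl
  · exact hq 0 2 0 2 rfl rfl

/-- On a plane of quadratic forms whose products are apolar to `w`, the bilinear form given by a
linear form is degenerate. -/
lemma exists_mul_mem_of_isotropic {f g : Form k 2} (hfg : LinearIndependent k ![f, g])
    (hff : (f * f : MvPolynomial (Fin 2) k) ∈ apolarIdeal w)
    (hf : (f * g : MvPolynomial (Fin 2) k) ∈ apolarIdeal w)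
    (hgg : (g * g : MvPolynomial (Fin 2) k) ∈ apolarIdeal w)
    {u : MvPolynomial (Fin 2) k} (hu : u.IsHomogeneous 1) :
    ∃ h : Form k 2, h ≠ 0 ∧ (h * u : MvPolynomial (Fin 2) k) ∈ apolarIdeal w := by
  obtain ⟨e, he⟩ := exists_linearIndependent_cons_of_lt_finrank hfg
    (by rw [finrank_form]; norm_num)
  have he' : LinearIndependent k ![e, f, g] := he
  have h1 := pairing_eq_zero_of_mem hff u
  have h2 := pairing_eq_zero_of_mem hf u
  have h3 := pairing_eq_zero_of_mem hgg u
  -- The form vanishes on the plane of $f$ and $g$, so a nonzero element of that plane orthogonal to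
  -- the third basis vector $e$ lies in the radical.
  obtain ⟨a, b, hab, h⟩ : ∃ a b : k, ¬ (a = 0 ∧ b = 0) ∧
      a * pairing w u f e + b * pairing w u g e = 0 := by
    by_cases hz : pairing w u f e = 0
    · exact ⟨1, 0, by simp, by simp [hz]⟩
    · exact ⟨pairing w u g e, -pairing w u f e, by simp [hz], by ring⟩
  refine ⟨a • f + b • g, fun h0 => hab (LinearIndependent.pair_iff.mp hfg a b h0),
    mul_mem_of_pairing hu fun q => ?_⟩
  obtain ⟨α, β, γ, rfl⟩ := exists_eq_combination he' q
  simp only [pairing_add_left, pairing_smul_left, pairing_add_right, pairing_smul_right,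
    pairing_comm u g f, h1, h2, h3]
  linear_combination α * h

lemma catalecticantRank_eq_three
    (hN : ∀ ψ : Form k 2, (ψ : MvPolynomial (Fin 2) k) ∈ apolarIdeal w → ψ = 0) :
    catalecticantRank w = 3 := by
  have h1 : apolarForms w 2 = ⊥ := (Submodule.eq_bot_iff _).mpr hN
  have h2 := catalecticantRank_add_quadrics w
  rw [h1, finrank_bot] at h2
  omega

lemma exists_cubic (h : catalecticantRank w = 3) : ∃ φ : Form k 3, φ ≠ 0 ∧
    ∀ ψ : Form k 3, (ψ : MvPolynomial (Fin 2) k) ∈ apolarIdeal w → ∃ t : k, t • φ = ψ := by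
  have h2 := catalecticantRank_add_cubics w
  have h3 : Module.finrank k (apolarForms w 3) = 1 := by omega
  have : Module.Free k (apolarForms w 3) := Module.Free.of_divisionRing k (apolarForms w 3)
  obtain ⟨φ, h0, hφ⟩ := (finrank_eq_one_iff' (K := k) (V := apolarForms w 3)).mp h3
  refine ⟨φ, fun e => h0 (Subtype.ext e), fun ψ hψ => ?_⟩
  obtain ⟨t, ht⟩ := hφ ⟨ψ, hψ⟩
  exact ⟨t, congrArg Subtype.val ht⟩

/-- Four zeros suffice: $(1,0)$, $(0,1)$, $(1,1)$ and $(1,-1)$, which are distinct points of the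
projective line because $2\ne0$. -/
lemma eq_zero_of_eval_cubic (h2 : (2 : k) ≠ 0) (φ : Form k 3)
    (h : ∀ s t : k, s ≠ 0 ∨ t ≠ 0 → eval ![s, t] (φ : MvPolynomial (Fin 2) k) = 0) : φ = 0 := by
  obtain ⟨c, rfl⟩ := (formEquiv k 3).surjective φ
  have e : ∀ s t, eval ![s, t] (formEquiv k 3 c : MvPolynomial (Fin 2) k) =
      c 0 * s ^ 3 + c 1 * (s ^ 2 * t) + c 2 * (s * t ^ 2) + c 3 * t ^ 3 := by
    intro s t
    rw [formEquiv_apply, coe_formOfCoeffs, map_sum, Fin.sum_univ_four]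
    simp
  have e0 := h 1 0 (by simp)
  have e1 := h 0 1 (by simp)
  have e2 := h 1 1 (by simp)
  have e3 := h 1 (-1) (by simp)
  rw [e] at e0 e1 e2 e3
  have c0 : c 0 = 0 := by linear_combination e0
  have c3 : c 3 = 0 := by linear_combination e1
  have c2 : c 2 = 0 := by
    refine (mul_eq_zero.mp (?_ : 2 * c 2 = 0)).resolve_left h2
    linear_combination e2 + e3 - 2 * c0
  have c1 : c 1 = 0 := by linear_combination e2 - c0 - c3 - c2
  have : c = 0 := by
    funext i
    fin_cases i
    · exact c0
    · exact c1
    · exact c2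
    · exact c3
  rw [this, map_zero]

/-- If the line through $f$ and $g$ lay on both conics, every linear $u$ would divide a nonzero
apolar cubic. Without apolar quadratics the apolar cubics are the multiples of one $\varphi$, so
$\varphi$ would vanish at every rational point. -/
lemma not_isotropic (h2 : (2 : k) ≠ 0)
    (hN : ∀ ψ : Form k 2, (ψ : MvPolynomial (Fin 2) k) ∈ apolarIdeal w → ψ = 0)
    {f g : Form k 2} (hfg : LinearIndependent k ![f, g])
    (hff : (f * f : MvPolynomial (Fin 2) k) ∈ apolarIdeal w)
    (hgg : (g * g : MvPolynomial (Fin 2) k) ∈ apolarIdeal w) :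
    (f * g : MvPolynomial (Fin 2) k) ∉ apolarIdeal w := by
  intro hf
  obtain ⟨φ, h0, hφ⟩ := exists_cubic (catalecticantRank_eq_three hN)
  refine h0 (eq_zero_of_eval_cubic h2 φ fun s t hst => ?_)
  -- The linear form $tx-sy$ is chosen because it vanishes at $(s,t)$.
  obtain ⟨q, hq0, hq⟩ := exists_mul_mem_of_isotropic hfg hff hf hgg (isHomogeneous_lin t (-s))
  obtain ⟨c, hc⟩ := hφ ⟨_, IsHomogeneous.mul q.2 (isHomogeneous_lin t (-s))⟩ hq
  have hc' : C c * (φ : MvPolynomial (Fin 2) k) =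
      (q : MvPolynomial (Fin 2) k) * lin t (-s) := by
    rw [← smul_eq_C_mul]
    exact congrArg Subtype.val hc
  have hlin : lin t (-s) ≠ 0 := by
    intro e
    have e1 := congrArg (eval ![1, 0]) e
    have e2 := congrArg (eval ![0, 1]) e
    rw [eval_lin, map_zero] at e1 e2
    rcases hst with hs | ht
    · exact hs (by linear_combination -e2)
    · exact ht (by linear_combination e1)
  have hc0 : c ≠ 0 := by
    rintro rfl
    rw [map_zero, zero_mul] at hc'
    exact mul_ne_zero (by simpa using hq0) hlin hc'.symm
  have := congrArg (eval ![s, t]) hc'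
  rw [map_mul, map_mul, eval_C, eval_lin] at this
  refine (mul_eq_zero.mp (?_ : c * _ = 0)).resolve_left hc0
  linear_combination this

/-- No three common points are collinear: if $a=\alpha b+\beta c$, then $a^2,b^2,c^2\in w^\perp$
give $2\alpha\beta\,bc\in w^\perp$, and the whole line through $b$ and $c$ is isotropic. -/
lemma not_mem_span_pair (h2 : (2 : k) ≠ 0)
    (hN : ∀ ψ : Form k 2, (ψ : MvPolynomial (Fin 2) k) ∈ apolarIdeal w → ψ = 0)
    {a b c : Form k 2} (ha : (a * a : MvPolynomial (Fin 2) k) ∈ apolarIdeal w)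
    (hb : (b * b : MvPolynomial (Fin 2) k) ∈ apolarIdeal w)
    (hc : (c * c : MvPolynomial (Fin 2) k) ∈ apolarIdeal w)
    (hab : LinearIndependent k ![a, b]) (hac : LinearIndependent k ![a, c])
    (hbc : LinearIndependent k ![b, c]) : a ∉ Submodule.span k {b, c} := by
  intro h
  obtain ⟨α, β, rfl⟩ := Submodule.mem_span_pair.mp h
  have hα : α ≠ 0 := by
    rintro rfl
    have := LinearIndependent.pair_iff.mp hac 1 (-β) (by simp)
    exact one_ne_zero this.1
  have hβ : β ≠ 0 := by
    rintro rfl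
    have := LinearIndependent.pair_iff.mp hab 1 (-α) (by simp)
    exact one_ne_zero this.1
  refine not_isotropic h2 hN hbc hb hc ?_
  rw [← Ideal.unit_mul_mem_iff_mem _ ((IsUnit.mk0 (2 * α * β)
    (mul_ne_zero (mul_ne_zero h2 hα) hβ)).map C)]
  have e : C (2 * α * β) * (b.1 * c.1) = (α • b + β • c).1 * (α • b + β • c).1 -
      C (α ^ 2) * (b.1 * b.1) - C (β ^ 2) * (c.1 * c.1) := by
    simp only [Submodule.coe_add, Submodule.coe_smul, smul_eq_C_mul, map_mul, map_pow, map_ofNat]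
    ring
  rw [e]
  exact Ideal.sub_mem _ (Ideal.sub_mem _ ha (Ideal.mul_mem_left _ _ hb)) (Ideal.mul_mem_left _ _ hc)

/-- Two conics of the pencil that is apolar to `w` meet in at most four points. -/
lemma not_exists_five_points (h2 : (2 : k) ≠ 0)
    (hN : ∀ ψ : Form k 2, (ψ : MvPolynomial (Fin 2) k) ∈ apolarIdeal w → ψ = 0)
    (v : Fin 5 → Form k 2) (hv : ∀ i, (v i * v i : MvPolynomial (Fin 2) k) ∈ apolarIdeal w)
    (hi : ∀ i j, i ≠ j → LinearIndependent k ![v i, v j]) : False := by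
  have hspan : ∀ {a b c}, a ≠ b → a ≠ c → b ≠ c → v a ∉ Submodule.span k {v b, v c} :=
    fun hab hac hbc => not_mem_span_pair h2 hN (hv _) (hv _) (hv _) (hi _ _ hab) (hi _ _ hac)
      (hi _ _ hbc)
  have hbasis : LinearIndependent k ![v 0, v 1, v 2] :=
    (linearIndependent_triple_iff (hi 1 2 (by decide))).mpr
      (hspan (by decide) (by decide) (by decide))
  obtain ⟨p, q, r, h3⟩ := exists_eq_combination hbasis (v 3)
  obtain ⟨p', q', r', h4⟩ := exists_eq_combination hbasis (v 4)
  have hr : r ≠ 0 := by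
    rintro rfl
    refine hspan (a := 3) (b := 0) (c := 1) (by decide) (by decide) (by decide) ?_
    exact Submodule.mem_span_pair.mpr ⟨p, q, by rw [h3, zero_smul, add_zero]⟩
  have hr' : r' ≠ 0 := by
    rintro rfl
    refine hspan (a := 4) (b := 0) (c := 1) (by decide) (by decide) (by decide) ?_
    exact Submodule.mem_span_pair.mpr ⟨p', q', by rw [h4, zero_smul, add_zero]⟩
  have hp : p ≠ 0 := by
    rintro rfl
    refine hspan (a := 3) (b := 1) (c := 2) (by decide) (by decide) (by decide) ?_
    exact Submodule.mem_span_pair.mpr ⟨q, r, by rw [h3, zero_smul, zero_add]⟩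
  -- Vanishing of this determinant would put $v_4$ on the line through $v_2$ and $v_3$.
  have hpq : p * q' - p' * q ≠ 0 := by
    intro e
    refine hspan (a := 4) (b := 2) (c := 3) (by decide) (by decide) (by decide) ?_
    refine Submodule.mem_span_pair.mpr ⟨r' - p' / p * r, p' / p, ?_⟩
    have e' : p' / p * q = q' := by
      field_simp
      linear_combination -e
    rw [h3, h4, ← e']
    simp only [smul_add, smul_smul, sub_smul, div_mul_cancel₀ _ hp]
    abel
  -- Some member of the pencil contains the whole line through $v_0$ and $v_1$: this is one linear
  -- condition on the two coefficients of $u$.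
  obtain ⟨u, hu, hu0, hu01⟩ : ∃ u : MvPolynomial (Fin 2) k, u.IsHomogeneous 1 ∧ u ≠ 0 ∧
      pairing w u (v 0) (v 1) = 0 := by
    let F := Frame.std k
    let α := pairing w F.l (v 0) (v 1)
    let β := pairing w F.m (v 0) (v 1)
    have hαβ : ¬ (β = 0 ∧ α = 0) := by
      rintro ⟨hβ, hα⟩
      refine not_isotropic h2 hN (hi 0 1 (by decide)) (hv 0) (hv 1) ?_
      refine mem_apolarIdeal_of_forall_form (d := 4) (e := 1) rfl
        (IsHomogeneous.mul (v 0).2 (v 1).2) fun x hx => ?_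
      obtain ⟨a, b, hab⟩ := F.exists_eq_linear ⟨x, hx⟩
      have hx' : x = C a * F.l + C b * F.m := congrArg Subtype.val hab
      rw [hx', mul_add, map_add, mul_left_comm, extend_C_mul, mul_left_comm, extend_C_mul,
        mul_comm _ F.l, mul_comm _ F.m]
      change a * α + b * β = 0
      rw [hα, hβ]
      ring
    refine ⟨F.linear β (-α), (F.linear β (-α)).2, ?_, ?_⟩
    · intro e
      have e' : F.linear β (-α) = 0 := by simpa using e
      rw [F.linear_eq_zero, neg_eq_zero] at e'
      exact hαβ e'
    · rw [pairing, Frame.coe_linear, add_mul, map_add, mul_assoc, mul_assoc, extend_C_mul,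
        extend_C_mul]
      change β * α + -α * β = 0
      ring
  have hd := fun i => pairing_eq_zero_of_mem (hv i) u
  have k3 := hd 3
  have k4 := hd 4
  rw [h3] at k3
  rw [h4] at k4
  simp only [pairing_add_left, pairing_smul_left, pairing_add_right, pairing_smul_right,
    pairing_comm u (v 1) (v 0), pairing_comm u (v 2) (v 0), pairing_comm u (v 2) (v 1), hd,
    hu01] at k3 k4
  set x := pairing w u (v 0) (v 2)
  set y := pairing w u (v 1) (v 2)
  -- In the basis $v_0,v_1,v_2$ the form of $u$ has only the entries $x$ and $y$ left; the points
  -- $v_3$ and $v_4$ give two independent linear equations for them.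
  have l3 : p * x + q * y = 0 := by
    refine (mul_eq_zero.mp (?_ : (2 * r) * _ = 0)).resolve_left (mul_ne_zero h2 hr)
    linear_combination k3
  have l4 : p' * x + q' * y = 0 := by
    refine (mul_eq_zero.mp (?_ : (2 * r') * _ = 0)).resolve_left (mul_ne_zero h2 hr')
    linear_combination k4
  have hx : x = 0 := by
    refine (mul_eq_zero.mp (?_ : _ * x = 0)).resolve_left hpq
    linear_combination q' * l3 - q * l4
  have hy : y = 0 := by
    refine (mul_eq_zero.mp (?_ : _ * y = 0)).resolve_left hpq
    linear_combination p * l4 - p' * l3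
  have hmem : u ∈ apolarIdeal w := by
    refine mem_apolarIdeal_of_pairing hu fun f g => ?_
    obtain ⟨a, b, c, rfl⟩ := exists_eq_combination hbasis f
    obtain ⟨a', b', c', rfl⟩ := exists_eq_combination hbasis g
    simp only [pairing_add_left, pairing_smul_left, pairing_add_right, pairing_smul_right,
      pairing_comm u (v 1) (v 0), pairing_comm u (v 2) (v 0), pairing_comm u (v 2) (v 1), hd,
      hu01]
    change a' * (a * 0 + b * 0 + c * x) + b' * (a * 0 + b * 0 + c * y) +
      c' * (a * x + b * y + c * 0) = 0
    rw [hx, hy]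
    ring
  -- An apolar linear form $u$ yields the apolar quadratic form $u^2$, which is excluded.
  exact mul_ne_zero hu0 hu0 (congrArg Subtype.val
    (hN ⟨u * u, hu.mul hu⟩ (Ideal.mul_mem_left _ _ hmem)))

end

lemma abs_legendreSum_le_four {p : ℕ} [Fact p.Prime] (hp : 2 < p) {w : DualForm (ZMod p) 5}
    (hN : ∀ ψ : Form (ZMod p) 2, (ψ : MvPolynomial (Fin 2) (ZMod p)) ∈ apolarIdeal w → ψ = 0) :
    |legendreSum w| ≤ 4 := by
  classical
  rw [legendreSum, abs_neg]
  refine (Frame.abs_sum_quadraticChar_le _ _ (n := 4) ?_).trans_eq Nat.cast_ofNat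
  by_contra hc
  obtain ⟨T, hT, hcard⟩ := Finset.exists_subset_card_eq (Nat.succ_le_of_lt (not_le.mp hc))
  let e := (T.equivFinOfCardEq hcard).symm
  refine not_exists_five_points (Frame.two_ne_zero_zmod hp) hN (fun i => (e i).1.rep)
    (fun i => ?_) fun i j hij => ?_
  · rw [← pow_two]
    exact (Finset.mem_filter.mp (hT (e i).2)).2
  · have hne : (e i).1 ≠ (e j).1 := fun h => hij (e.injective (Subtype.ext h))
    exact Projectivization.linearIndependent_pair_iff_ne.mpr hne

end

section

/-! ### Waring types -/

section
variable {k : Type*} [Field k] {w : DualForm k 5}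

lemma ne_zero_of_catalecticantRank (h : catalecticantRank w ≠ 0) : w ≠ 0 := by
  rintro rfl
  exact h catalecticantRank_zero

lemma Frame.l_mem_of_coords (F : Frame k) (h0 : F.coords w 0 = 0) (h1 : F.coords w 1 = 0)
    (h2 : F.coords w 2 = 0) (h3 : F.coords w 3 = 0) (h4 : F.coords w 4 = 0) :
    F.l ∈ apolarIdeal w := by
  have := F.linear_mem_iff (w := w) 1 0
  rw [coe_linear, map_one, map_zero, one_mul, zero_mul, add_zero] at this
  rw [this]
  intro i hi
  interval_cases i <;> simp [h0, h1, h2, h3, h4]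

lemma Frame.hasWaringType_of_l_sq (F : Frame k) (hw : w ≠ 0) (h : F.l ^ 2 ∈ apolarIdeal w) :
    HasWaringType w {(1, 1)} ∨ HasWaringType w {(1, 2)} := by
  obtain ⟨h0, h1, h2, h3⟩ := F.l_sq_mem_iff.mp h
  -- This coordinate decides whether $l$ itself is already apolar.
  by_cases h4 : F.coords w 4 = 0
  · have hl := F.l_mem_of_coords h0 h1 h2 h3 h4
    refine Or.inl (hasWaringType_singleton.mpr ⟨F.l, F.irreducible_l, F.isHomogeneous_l, le_rfl,
      ?_, by rwa [pow_one]⟩)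
    exact catalecticantRank_eq_one F.isHomogeneous_l F.l_ne_zero hw hl
  · exact Or.inr (hasWaringType_singleton.mpr ⟨F.l, F.irreducible_l, F.isHomogeneous_l,
      one_le_two, F.catalecticantRank_of_l_sq h h4, h⟩)

lemma exists_frame_of_hasWaringType_linear {e : ℕ} (he : e ≤ 2) (h : HasWaringType w {(1, e)}) :
    w ≠ 0 ∧ ∃ F : Frame k, F.l ^ 2 ∈ apolarIdeal w := by
  obtain ⟨g, h1, h2, h3, h4, h5⟩ := hasWaringType_singleton.mp h
  obtain ⟨F, rfl⟩ := Frame.exists_of_ne_zero h2 h1.ne_zero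
  exact ⟨ne_zero_of_catalecticantRank (by omega), F, (apolarIdeal w).mem_of_dvd (pow_dvd_pow _ he) h5⟩

lemma not_dvd_of_irreducible_quadratic {f g : MvPolynomial (Fin 2) k} (hf : f.IsHomogeneous 1)
    (hg : g.IsHomogeneous 2) (hi : Irreducible g) : ¬ f ∣ g := by
  rintro ⟨u, rfl⟩
  obtain ⟨i, j, hij, hi', hj⟩ := exists_isHomogeneous_of_mul hg hi.ne_zero
  have h1 := hi'.inj_right hf (left_ne_zero_of_mul hi.ne_zero)
  rcases hi.isUnit_or_isUnit rfl with hu | hu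
  · have := hf.inj_right (isHomogeneous_zero_of_isUnit hu) hu.ne_zero
    omega
  · have := hj.inj_right (isHomogeneous_zero_of_isUnit hu) hu.ne_zero
    omega

/-- Completing the square in an irreducible quadratic form. -/
lemma exists_frame_of_irreducible_quadratic (h2 : (2 : k) ≠ 0) {g : MvPolynomial (Fin 2) k}
    (hg : g.IsHomogeneous 2) (hi : Irreducible g) :
    ∃ (F : Frame k) (d : k), ¬ IsSquare d ∧ Associated g (F.m ^ 2 - C d * F.l ^ 2) := by
  obtain ⟨A, B, E, h⟩ := (Frame.std k).exists_eq_quad ⟨g, hg⟩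
  have hg' : g = C A * X 0 ^ 2 + C B * (X 0 * X 1) + C E * X 1 ^ 2 := by
    have := congrArg Subtype.val h
    simpa [Frame.coe_quad, Frame.std, Frame.l, Frame.m, lin] using this
  have hA : A ≠ 0 := by
    rintro rfl
    refine not_dvd_of_irreducible_quadratic (isHomogeneous_X k (1 : Fin 2)) hg hi
      ⟨C B * X 0 + C E * X 1, ?_⟩
    rw [hg', map_zero]
    ring
  -- With $l=y$ and $m=x+by$ one gets $g=A(m^2-dl^2)$; a square $d$ would split $g$.
  let b := B / (2 * A)
  let d := b ^ 2 - E / A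
  let F : Frame k := ⟨0, 1, 1, b, by simp⟩
  have hF : g = (F.m ^ 2 - C d * F.l ^ 2) * C A := by
    have e1 : B = 2 * b * A := by simp only [b]; field_simp
    have e2 : E = (b ^ 2 - d) * A := by simp only [d]; field_simp; ring
    rw [hg', e1, e2]
    simp only [F, Frame.l, Frame.m, lin, map_mul, map_sub, map_pow, map_ofNat, map_zero, map_one]
    ring
  refine ⟨F, d, ?_, ?_⟩
  · rintro ⟨s, hs⟩
    refine not_dvd_of_irreducible_quadratic (F.linear s 1).2 hg hi
      ⟨(F.linear (-s) 1 : MvPolynomial (Fin 2) k) * C A, ?_⟩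
    rw [hF, hs, Frame.coe_linear, Frame.coe_linear, map_neg, map_one, map_mul]
    ring
  · rw [hF]
    exact (associated_mul_unit_left _ _ ((IsUnit.mk0 A hA).map C))

lemma hasWaringType_of_irreducible_quadratic (h2 : (2 : k) ≠ 0) {g : MvPolynomial (Fin 2) k}
    (hw : w ≠ 0) (hg : g.IsHomogeneous 2) (hi : Irreducible g) (h : g ∈ apolarIdeal w) :
    HasWaringType w {(2, 1)} := by
  obtain ⟨F, d, hd, hF⟩ := exists_frame_of_irreducible_quadratic h2 hg hi
  exact hasWaringType_singleton.mpr ⟨g, hi, hg, le_rfl,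
    F.catalecticantRank_of_m_sq_sub (mem_ideal_of_associated hF h) hd hw, by rwa [pow_one]⟩

/-- If an outer coordinate of $w$ vanishes, then $l^2$ or $m^2$ is apolar too; otherwise the rank is
2 and $lm$ is the generator. -/
lemma Frame.hasWaringType_of_l_mul_m (F : Frame k) (hw : w ≠ 0)
    (h : F.l * F.m ∈ apolarIdeal w) : HasWaringType w {(1, 1)} ∨ HasWaringType w {(1, 2)} ∨
      HasWaringType w {(1, 1), (1, 1)} := by
  obtain ⟨h1, h2, h3, h4⟩ := F.l_mul_m_mem_iff.mp h
  by_cases h0 : F.coords w 0 = 0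
  · exact (F.hasWaringType_of_l_sq hw (F.l_sq_mem_iff.mpr ⟨h0, h1, h2, h3⟩)).imp_right Or.inl
  by_cases h5 : F.coords w 5 = 0
  · have := (F.quad_mem_iff' (w := w) 0 0 1).mpr (by simp [h2, h3, h4, h5])
    refine (F.swap.hasWaringType_of_l_sq hw ?_).imp_right Or.inl
    simpa [coe_quad] using this
  · refine Or.inr (Or.inr (hasWaringType_pair.mpr ⟨F.l, F.m, ⟨F.irreducible_l, F.isHomogeneous_l⟩,
      ⟨F.irreducible_m, F.isHomogeneous_m⟩, le_rfl, le_rfl, fun e => F.not_l_dvd_m e.dvd,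
      F.catalecticantRank_of_l_mul_m h h0 h5, by rwa [pow_one, pow_one]⟩))

lemma exists_mul_of_not_irreducible {g : MvPolynomial (Fin 2) k} (hg : g.IsHomogeneous 2)
    (h0 : g ≠ 0) (hi : ¬ Irreducible g) :
    ∃ f₁ f₂, f₁.IsHomogeneous 1 ∧ f₂.IsHomogeneous 1 ∧ g = f₁ * f₂ := by
  have hu : ¬ IsUnit g := fun hu => by
    have := hg.inj_right (isHomogeneous_zero_of_isUnit hu) h0
    omega
  simp only [irreducible_iff, hu, not_false_iff, true_and, not_forall, not_or] at hi
  obtain ⟨a, b, rfl, ha, hb⟩ := hi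
  obtain ⟨i, j, hij, hi, hj⟩ := exists_isHomogeneous_of_mul hg h0
  have hi0 : i ≠ 0 := by
    rintro rfl
    exact ha (isUnit_of_isHomogeneous_zero hi (left_ne_zero_of_mul h0))
  have hj0 : j ≠ 0 := by
    rintro rfl
    exact hb (isUnit_of_isHomogeneous_zero hj (right_ne_zero_of_mul h0))
  obtain rfl : i = 1 := by omega
  obtain rfl : j = 1 := by omega
  exact ⟨a, b, hi, hj, rfl⟩

/-- A functional with an apolar quadratic form has one of four Waring types. -/
lemma hasWaringType_of_quadratic (h2 : (2 : k) ≠ 0) (hw : w ≠ 0) {ψ : Form k 2} (h0 : ψ ≠ 0)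
    (h : (ψ : MvPolynomial (Fin 2) k) ∈ apolarIdeal w) :
    HasWaringType w {(1, 1)} ∨ HasWaringType w {(1, 2)} ∨ HasWaringType w {(1, 1), (1, 1)} ∨
      HasWaringType w {(2, 1)} := by
  by_cases hi : Irreducible (ψ : MvPolynomial (Fin 2) k)
  · exact Or.inr (Or.inr (Or.inr (hasWaringType_of_irreducible_quadratic h2 hw ψ.2 hi h)))
  · have h0' : (ψ : MvPolynomial (Fin 2) k) ≠ 0 := by simpa using h0
    obtain ⟨f₁, f₂, hf1, hf2, e⟩ := exists_mul_of_not_irreducible ψ.2 h0' hi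
    rw [e] at h h0'
    have n1 := left_ne_zero_of_mul h0'
    by_cases ha : Associated f₁ f₂
    · obtain ⟨F, rfl⟩ := Frame.exists_of_ne_zero hf1 n1
      have : F.l ^ 2 ∈ apolarIdeal w := by
        rw [pow_two]
        exact mem_ideal_of_associated (ha.symm.mul_left F.l) h
      exact (F.hasWaringType_of_l_sq hw this).imp_right Or.inl
    · obtain ⟨F, rfl, rfl⟩ :=
        Frame.exists_of_not_associated hf1 hf2 n1 (right_ne_zero_of_mul h0') ha
      rcases F.hasWaringType_of_l_mul_m hw h with h | h | h
      · exact Or.inl h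
      · exact Or.inr (Or.inl h)
      · exact Or.inr (Or.inr (Or.inl h))

lemma Frame.not_coords_eq_zero (F : Frame k) (hw : w ≠ 0) (h : catalecticantRank w ≠ 1) :
    ¬ (F.coords w 0 = 0 ∧ F.coords w 1 = 0 ∧ F.coords w 2 = 0 ∧ F.coords w 3 = 0 ∧
      F.coords w 4 = 0) := by
  rintro ⟨e0, e1, e2, e3, e4⟩
  exact h (catalecticantRank_eq_one F.isHomogeneous_l F.l_ne_zero hw
    (F.l_mem_of_coords e0 e1 e2 e3 e4))

lemma Frame.swap_coords (F : Frame k) {i j : ℕ} (h : i + j = 5) :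
    F.swap.coords w i = F.coords w j := by
  obtain rfl : i = 5 - j := by omega
  rw [coords, coords, swap_l, swap_m, mul_comm, Nat.sub_sub_self (by omega)]

lemma Frame.l_sq_not_mem (F : Frame k) (h : catalecticantRank w = 3) : F.l ^ 2 ∉ apolarIdeal w :=
  fun hl => F.l_ne_zero (pow_eq_zero_iff two_ne_zero |>.mp (congrArg Subtype.val
    (eq_zero_of_quadratic_mem h (ψ := ⟨F.l ^ 2, F.isHomogeneous_l.pow 2⟩) hl)))

lemma Frame.l_mul_m_not_mem (F : Frame k) (h : catalecticantRank w = 3) :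
    F.l * F.m ∉ apolarIdeal w :=
  fun hl => mul_ne_zero F.l_ne_zero F.m_ne_zero (congrArg Subtype.val
    (eq_zero_of_quadratic_mem h (ψ := ⟨_, F.isHomogeneous_l.mul F.isHomogeneous_m⟩) hl))

end

/-! ### The sums for each Waring type -/

section
variable {p : ℕ} [Fact p.Prime] {w : DualForm (ZMod p) 5}

lemma singularExpSum_zero (hp : 2 < p) : singularExpSum (0 : DualForm (ZMod p) 5) =
    (p : ℂ) ^ (-1 : ℤ) + (p : ℂ) ^ (-2 : ℤ) - (p : ℂ) ^ (-3 : ℤ) := by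
  have hp0 : (p : ℂ) ≠ 0 := Nat.cast_ne_zero.mpr (by omega)
  rw [singularExpSum_eq hp, (Frame.counts_zero hp).1, (Frame.counts_zero hp).2]
  push_cast
  simp only [zpow_neg]
  norm_cast
  push_cast
  field_simp
  ring

lemma singularExpSum_of_l_sq (hp : 2 < p) (hw : w ≠ 0) (F : Frame (ZMod p))
    (h : F.l ^ 2 ∈ apolarIdeal w) :
    singularExpSum w = (p : ℂ) ^ (-2 : ℤ) - (p : ℂ) ^ (-3 : ℤ) := by
  have hp0 : (p : ℂ) ≠ 0 := Nat.cast_ne_zero.mpr (by omega)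
  rw [singularExpSum_eq hp, (F.counts_of_l_sq hw h).1, (F.counts_of_l_sq hw h).2]
  push_cast
  simp only [zpow_neg]
  norm_cast
  push_cast
  field_simp
  ring

lemma numSquares_eq_zero (hw : w ≠ 0) (h1 : ¬ HasWaringType w {(1, 1)})
    (h2 : ¬ HasWaringType w {(1, 2)}) : numSquares w = 0 := by
  classical
  rw [numSquares]
  refine Finset.sum_eq_zero fun P _ => if_neg fun hP => ?_
  obtain ⟨F, hF⟩ := Frame.exists_of_ne_zero P.rep.2 (coe_rep_ne_zero P)
  rw [← hF] at hP
  exact (F.hasWaringType_of_l_sq hw hP).elim h1 h2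

lemma legendreSum_of_type_one_one (h : HasWaringType w {(1, 1), (1, 1)}) : legendreSum w = -1 := by
  obtain ⟨g₁, g₂, h1, h2, -, -, h3, h4, h5⟩ := hasWaringType_pair.mp h
  obtain ⟨F, rfl, rfl⟩ := Frame.exists_of_not_associated h1.2 h2.2 h1.1.ne_zero h2.1.ne_zero h3
  rw [pow_one, pow_one] at h5
  obtain ⟨a1, a2, a3, a4⟩ := F.l_mul_m_mem_iff.mp h5
  have hw := ne_zero_of_catalecticantRank (w := w) (by omega)
  have hr : catalecticantRank w ≠ 1 := by omega
  exact F.legendreSum_of_l_mul_m h5 (fun h0 => F.not_coords_eq_zero hw hr ⟨h0, a1, a2, a3, a4⟩)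
    fun h5 => F.swap.not_coords_eq_zero hw hr ⟨(F.swap_coords rfl).trans h5,
      (F.swap_coords rfl).trans a4, (F.swap_coords rfl).trans a3, (F.swap_coords rfl).trans a2,
      (F.swap_coords rfl).trans a1⟩

lemma legendreSum_of_type_two (hp : 2 < p) (h : HasWaringType w {(2, 1)}) : legendreSum w = 1 := by
  obtain ⟨g, h1, h2, -, h4, h5⟩ := hasWaringType_singleton.mp h
  obtain ⟨F, d, hd, hF⟩ :=
    exists_frame_of_irreducible_quadratic (Frame.two_ne_zero_zmod hp) h2 h1
  rw [pow_one] at h5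
  exact F.legendreSum_of_m_sq_sub hp (mem_ideal_of_associated hF h5) hd
    (ne_zero_of_catalecticantRank (by omega))

lemma legendreSum_of_type_cube (hp : 2 < p) (h : HasWaringType w {(1, 3)}) :
    |legendreSum w| ≤ 1 := by
  obtain ⟨g, h1, h2, -, h4, h5⟩ := hasWaringType_singleton.mp h
  obtain ⟨F, rfl⟩ := Frame.exists_of_ne_zero h2 h1.ne_zero
  refine F.legendreSum_of_l_cube hp h5 fun h3 => F.l_sq_not_mem (by omega) ?_
  obtain ⟨a0, a1, a2⟩ := F.l_cube_mem_iff.mp h5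
  exact F.l_sq_mem_iff.mpr ⟨a0, a1, a2, h3⟩

lemma legendreSum_of_type_square_mul (hp : 2 < p) (h : HasWaringType w {(1, 2), (1, 1)}) :
    |legendreSum w + 1| ≤ 2 := by
  obtain ⟨g₁, g₂, h1, h2, -, -, h3, h4, h5⟩ := hasWaringType_pair.mp h
  obtain ⟨F, rfl, rfl⟩ := Frame.exists_of_not_associated h1.2 h2.2 h1.1.ne_zero h2.1.ne_zero h3
  rw [pow_one] at h5
  obtain ⟨a1, a2, a3⟩ := F.l_sq_mul_m_mem_iff.mp h5
  -- If coordinate 0 vanished, $l^2$ would be apolar; if coordinate 4 did, $lm$ would be. Rank 3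
  -- excludes both.
  refine F.legendreSum_of_l_sq_mul_m hp h5
    (fun h0 => F.l_sq_not_mem (by omega) (F.l_sq_mem_iff.mpr ⟨h0, a1, a2, a3⟩))
    (fun h4 => F.l_mul_m_not_mem (by omega) (F.l_mul_m_mem_iff.mpr ⟨a1, a2, a3, h4⟩))

end

end

end BinaryForms

end

theorem mainTheorem2 (p : ℕ) [Fact p.Prime] (hp : 2 < p)
    (w : BinaryForms.DualForm (ZMod p) 5) :
    (w = 0 →
      BinaryForms.singularExpSum w
        = (p : ℂ) ^ (-1 : ℤ) + (p : ℂ) ^ (-2 : ℤ) - (p : ℂ) ^ (-3 : ℤ)) ∧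
    (BinaryForms.HasWaringType w {(1, 1)} →
      BinaryForms.singularExpSum w = (p : ℂ) ^ (-2 : ℤ) - (p : ℂ) ^ (-3 : ℤ)) ∧
    (BinaryForms.HasWaringType w {(1, 2)} →
      BinaryForms.singularExpSum w = (p : ℂ) ^ (-2 : ℤ) - (p : ℂ) ^ (-3 : ℤ)) ∧
    (w ≠ 0 → ¬ BinaryForms.HasWaringType w {(1, 1)} → ¬ BinaryForms.HasWaringType w {(1, 2)} →
      BinaryForms.singularExpSum w = (BinaryForms.legendreSum w : ℂ) * (p : ℂ) ^ (-4 : ℤ) ∧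
      (BinaryForms.HasWaringType w {(1, 1), (1, 1)} →
        BinaryForms.legendreSum w = -1) ∧
      (BinaryForms.HasWaringType w {(2, 1)} →
        BinaryForms.legendreSum w = 1) ∧
      (BinaryForms.HasWaringType w {(1, 3)} →
        BinaryForms.legendreSum w ∈ ({0, 1, -1} : Set ℤ)) ∧
      (BinaryForms.HasWaringType w {(1, 2), (1, 1)} →
        BinaryForms.legendreSum w ∈ ({0, 1, -1, -2, -3} : Set ℤ)) ∧
      (¬ BinaryForms.HasWaringType w {(1, 1), (1, 1)} → ¬ BinaryForms.HasWaringType w {(2, 1)} →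
        ¬ BinaryForms.HasWaringType w {(1, 3)} → ¬ BinaryForms.HasWaringType w {(1, 2), (1, 1)} →
        BinaryForms.legendreSum w ∈ ({0, 1, -1, 2, -2, 3, -3, 4, -4} : Set ℤ))) := by

  refine ⟨?_, fun h => ?_, fun h => ?_, fun hw h1 h2 => ⟨?_, fun h => ?_, fun h => ?_, fun h => ?_,
    fun h => ?_, fun h3 h4 _ _ => ?_⟩⟩
  · rintro rfl
    exact BinaryForms.singularExpSum_zero hp
  · obtain ⟨hw, F, hF⟩ := BinaryForms.exists_frame_of_hasWaringType_linear one_le_two h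
    exact BinaryForms.singularExpSum_of_l_sq hp hw F hF
  · obtain ⟨hw, F, hF⟩ := BinaryForms.exists_frame_of_hasWaringType_linear le_rfl h
    exact BinaryForms.singularExpSum_of_l_sq hp hw F hF
  · rw [BinaryForms.singularExpSum_eq hp, BinaryForms.numSquares_eq_zero hw h1 h2, Nat.cast_zero,
      zero_mul, zero_add]
  · exact BinaryForms.legendreSum_of_type_one_one h
  · exact BinaryForms.legendreSum_of_type_two hp h
  · have := abs_le.mp (BinaryForms.legendreSum_of_type_cube hp h)
    simp only [Set.mem_insert_iff, Set.mem_singleton_iff]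
    omega
  · have := abs_le.mp (BinaryForms.legendreSum_of_type_square_mul hp h)
    simp only [Set.mem_insert_iff, Set.mem_singleton_iff]
    omega
  -- An apolar quadratic form would force one of the four excluded types, so the bound for the
  -- pencil of conics applies.
  · have := abs_le.mp (BinaryForms.abs_legendreSum_le_four hp (w := w) fun ψ hψ => by
      by_contra h0
      rcases BinaryForms.hasWaringType_of_quadratic (BinaryForms.Frame.two_ne_zero_zmod hp) hw h0 hψ
        with h | h | h | h
      · exact h1 h
      · exact h2 h
      · exact h3 h
      · exact h4 h)
    simp only [Set.mem_insert_iff, Set.mem_singleton_iff]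
    omega
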